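/- Conventions. A dynamical system $(X,\mathcal B,\mu,T)$ is a measure space with a one-to-one, onto, measurable map $T:X\to X$ preserving $\mu$. For real $p$, $L\mathrm{Log}^pL(\mu)$ is the set of real $f\in L_1(\mu)$ with $\int|f|\,(\log(|f|+1))^p\,d\mu<\infty$. A perturbed block sequence is the increasing enumeration $(n_j)_{j\ge0}$ of a set $\bigcup_{k\ge1}(B_k\cup D_k)$, where each $B_k$ is a nonempty finite set of consecutive positive integers, $B_k$ lies to the left of $B_{k+1}$, and $D_k$ is a (possibly empty) set of integers lying strictly between $B_k$ and $B_{k+1}$. The averages of $f$ along $(n_j)$ are $A_Nf(x)=\frac1N\sum_{j=0}^{N-1}f(T^{n_j}x)$. A sequence is universally good for $L\mathrm{Log}^pL$ if for every dynamical system and every $f\in L\mathrm{Log}^pL(\mu)$ the averages $A_Nf(x)$ converge to a finite limit for $\mu$-a.e. $x$. Let $s>0$, and let $T(x)=x+\alpha \bmod 1$ on $[0,1)$ with Lebesgue measure, where $\alpha$ is irrational. For $k\ge3$ put $$s_k=\frac{k}{(\log k)^{s-1}(\log\log k)^{s}},\qquad c_k=\frac{\log\log k}{s_k},$$ and for $\epsilon>0$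 let $$g_s(x)=\frac{\log\log\frac2x+1}{\frac x2\,(\log\frac2x)^{s+1}(\log\log\frac2x)^{s+1}}\,\chi_{[0,\epsilon]}(x)\qquad(0<x<1).$$ Call $\epsilon$ admissible if $\log\frac2x>0$ and $\log\log\frac2x>0$ for $0<x\le\epsilon$ and $g_s$ is monotone decreasing on $(0,1)$. Then admissible $\epsilon$ exist, and for every admissible $\epsilon$: 1. $g_s\in L\mathrm{Log}^pL([0,1))$ for every $p<s$ if $s\le1$, and for every $p\le s$ if $s>1$. 2. There is a perturbed block sequence $(n_j)$, with blocks $B_k$ and perturbations $D_k$ satisfying $|D_k|=\lfloor c_k|B_k|\rfloor$ for all $k\ge3$, such that (a) for almost every $x\in[0,1)$ the averages $\frac1N\sum_{j=0}^{N-1}g_s(T^{n_j}x)$ do not converge to a finite limit as $N\to\infty$; (b) for every $p>s$ the same sequence $(n_j)$ is universally good for $L\mathrm{Log}^pL$; in particular, the averages along $(n_j)$ over the rotation $T$ converge a.e. for every $f\in L\mathrm{Log}^pL([0,1))$. -/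

import Mathlib

open MeasureTheory Filter Topology

universe u

/-- `T` is a measure preserving transformation of the measure space `(X, μ)`, that is,
`(X, μ, T)` is a dynamical system. -/
structure IsDynamicalSystem {X : Type u} [MeasurableSpace X] (μ : Measure X) (T : X → X) :
    Prop where
  bijective : Function.Bijective T
  measurePreserving : MeasurePreserving T μ μ

/-- The class `L Log^p L`: integrable functions `f` with `∫ |f| (log (|f| + 1))^p dμ < ∞`. -/
def MemLLogL {X : Type u} [MeasurableSpace X] (p : ℝ) (f : X → ℝ) (μ : Measure X) : Prop :=
  Integrable f μ ∧ Integrable (fun x => |f x| * Real.log (|f x| + 1) ^ p) μ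

/-- The average `(1 / N) * ∑_{k < N} f (T^{n_k} x)`. -/
noncomputable def subseqAverage {X : Type u} (T : X → X) (n : ℕ → ℕ) (f : X → ℝ) (N : ℕ)
    (x : X) : ℝ :=
  (1 / (N : ℝ)) * ∑ k ∈ Finset.range N, f (T^[n k] x)

/-- The averages of `f` along `n` converge (to a finite limit) at the point `x`. -/
def AveragesConvergeAt {X : Type u} (T : X → X) (n : ℕ → ℕ) (f : X → ℝ) (x : X) : Prop :=
  ∃ L : ℝ, Tendsto (fun N : ℕ => subseqAverage T n f N x) atTop (𝓝 L)

/-- The sequence `n` is universally good for `L Log^p L`: in every dynamical system, the averages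
along `n` of every function of class `L Log^p L` converge almost everywhere. -/
def IsUniversallyGoodLLogL (p : ℝ) (n : ℕ → ℕ) : Prop :=
  ∀ (X : Type u) [MeasurableSpace X] (μ : Measure X) (T : X → X), IsDynamicalSystem μ T →
    ∀ f : X → ℝ, MemLLogL p f μ → ∀ᵐ x ∂μ, AveragesConvergeAt T n f x

/-- The rotation `x ↦ x + α mod 1` of `[0, 1)`. -/
noncomputable def circleRotation (α : ℝ) (x : Set.Ico (0 : ℝ) 1) : Set.Ico (0 : ℝ) 1 :=
  ⟨Int.fract ((x : ℝ) + α), Set.mem_Ico.2 ⟨Int.fract_nonneg _, Int.fract_lt_one _⟩⟩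

/-- Lebesgue measure on `[0, 1)`. -/
noncomputable def lebesgueIco : Measure (Set.Ico (0 : ℝ) 1) :=
  Measure.comap Subtype.val volume

/-- `B 1, B 2, …` are blocks (nonempty intervals) of positive integers, each to the left of the
next, and for every `k ≥ 1` the (possibly empty) set `D k` lies strictly between `B k` and
`B (k + 1)`. The values `B 0` and `D 0` play no role. -/
structure IsPerturbedBlockFamily (B D : ℕ → Finset ℕ) : Prop where
  isBlock : ∀ k ≥ 1, ∃ a l : ℕ, 1 ≤ a ∧ 1 ≤ l ∧ B k = Finset.Ico a (a + l)
  block_lt_block : ∀ k ≥ 1, ∀ b ∈ B k, ∀ b' ∈ B (k + 1), b < b'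
  block_lt_pert : ∀ k ≥ 1, ∀ b ∈ B k, ∀ d ∈ D k, b < d
  pert_lt_block : ∀ k ≥ 1, ∀ d ∈ D k, ∀ b ∈ B (k + 1), d < b

/-- `n` is the increasing enumeration of `⋃_{k ≥ 1} (B k ∪ D k)`. -/
def Enumerates (n : ℕ → ℕ) (B D : ℕ → Finset ℕ) : Prop :=
  StrictMono n ∧ Set.range n = {m : ℕ | ∃ k ≥ 1, m ∈ B k ∪ D k}

/-- `s_k = k / ((log k)^(s-1) (log log k)^s)`, meaningful for `k ≥ 3`. -/
noncomputable def levelSeq (s : ℝ) (k : ℕ) : ℝ :=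
  (k : ℝ) / (Real.log k ^ (s - 1) * Real.log (Real.log k) ^ s)

/-- `c_k = log log k / s_k`, meaningful for `k ≥ 3`. -/
noncomputable def ratioSeq (s : ℝ) (k : ℕ) : ℝ :=
  Real.log (Real.log k) / levelSeq s k

/-- The function `g_s`, cut off at `ε` (its value at `0` is `0` and is irrelevant). -/
noncomputable def gFun (s ε : ℝ) : ℝ → ℝ :=
  Set.indicator (Set.Icc 0 ε) fun x =>
    (Real.log (Real.log (2 / x)) + 1) /
      (x / 2 * Real.log (2 / x) ^ (s + 1) * Real.log (Real.log (2 / x)) ^ (s + 1))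

/-- `ε` is small enough for `g_s`: the logarithms in its definition are positive on `(0, ε]`, and
`g_s` is monotone decreasing on `(0, 1)`. -/
structure IsAdmissibleCutoff (s ε : ℝ) : Prop where
  pos : 0 < ε
  log_pos : ∀ x ∈ Set.Ioc 0 ε, 0 < Real.log (2 / x)
  log_log_pos : ∀ x ∈ Set.Ioc 0 ε, 0 < Real.log (Real.log (2 / x))
  antitoneOn : AntitoneOn (gFun s ε) (Set.Ioo 0 1)

/-! The block lengths and the positions of the perturbations are free, so two requirements can be
met at once: the blocks alone behave like ordinary ergodic averages, and each `D k` is aimed at the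
singularity of `g_s`.

Blocks. If each block is at least as long as its starting point, the windows that control the block
averages form a sparse family of shifts: at every scale at most one shift exceeds the scale. A
covering argument on the integers (`SparseShifts.covering`), transferred along orbits, gives a weak
type (1,1) inequality (`SparseShifts.weak_type`). Together with the mean ergodic theorem on simple
functions this yields convergence a.e. of block averages for every integrable function
(`BlockLayout.ae_tendsto_blockAverage`). No finiteness of the measure is used.

Perturbations for `p > s`. Since `|D k| / l k` tends to 0, it suffices that the sums of `|f|` over
`D k`, divided by `l k`, tend to 0 (`BlockLayout.tendsto_average`). Cut `f` at height `√k`: the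
bounded part contributes at most `c_k √k`, which tends to 0. The unbounded parts have summable
integrals, because the `c_k` with `√k < |f|` add up to `O(1 + log(|f|+1)^p)` (`ae_tendsto_pert`,
`sum_abs_ratioSeq_le`).

Divergence for `g_s`. If the averages converged at `x`, the sums of `g_s` over `D k`, divided by `l
k`, would tend to 0 (`BlockLayout.tendsto_pert_of_tendsto_average`). Let `e = 1/(k log k)` and take
the target `[S, S+e]` with `S = log log k`. Choose `D k` so that its multiples of `α` fall one in
each cell of an equal partition of `[-S-e, -S+e]` modulo 1. For `x` in the target, a portion of the
orbit then samples `[0, e]` evenly, and the sum over `D k` is about `|D k| / (2e)` times the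
integral of `g_s` over `[0, e]`. That integral is explicit, `(2/s)(log(2/e) log log(2/e))^(-s)`, and
with `|D k|` about `c_k l k` the sum is at least `l k` for large `k`
(`IsAdmissibleCutoff.exists_pert`, `eventually_le_ratioSeq_mul_gPrim`). Consecutive targets leave no
gap and `log log k` is unbounded, so every point of the circle is hit infinitely often
(`exists_add_int_mem_target`). Divergence thus holds at every point.

The integrability of `g_s` follows from the same explicit primitive (`IsAdmissibleCutoff.memLLogL`).
-/

open scoped ENNReal

/-! ### Covering by sparse families of windows -/

/-- A set `Ω` of pairs (shift, length) is sparse if at each scale `L` all shifts occurring with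
length at most `L` lie in `[0, L]`, up to one exceptional shift. -/
def SparseShifts (Ω : Set (ℕ × ℕ)) : Prop :=
  (∀ p ∈ Ω, 1 ≤ p.2) ∧ ∀ L : ℕ, ∃ a₀ : ℕ, ∀ p ∈ Ω, p.2 ≤ L → p.1 ≤ L ∨ p.1 = a₀

/-- A one-sided covering lemma: the points whose shifted window has large mass are few. -/
theorem SparseShifts.covering {Ω : Set (ℕ × ℕ)} (hΩ : SparseShifts Ω) (φ : ℕ → ℝ≥0∞)
    (c : ℝ≥0∞) (q : ℕ → ℕ × ℕ) (hq : ∀ x, q x ∈ Ω) (S : Finset ℕ)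
    (hS : ∀ x ∈ S, c * (q x).2 ≤ ∑ i ∈ Finset.Ico (x + (q x).1) (x + (q x).1 + (q x).2), φ i) :
    c * S.card ≤
      5 * ∑ i ∈ S.biUnion fun x => Finset.Ico (x + (q x).1) (x + (q x).1 + (q x).2), φ i := by
  induction' h : S.card using Nat.strong_induction_on with n ih generalizing S
  rcases S.eq_empty_or_nonempty with rfl | hne
  · simp at h; simp [← h]
  set I : ℕ → Finset ℕ := fun x => Finset.Ico (x + (q x).1) (x + (q x).1 + (q x).2) with hI
  -- Vitali selection: take a longest window, discard all points whose window meets it, and apply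
  -- induction to the rest.
  obtain ⟨z, hz, hmax⟩ := S.exists_max_image (fun x => (q x).2) hne
  obtain ⟨a₀, ha₀⟩ := hΩ.2 (q z).2
  have hm1 : 1 ≤ (q z).2 := hΩ.1 _ (hq z)
  set m := (q z).2 with hm
  set w := z + (q z).1 with hw
  set S₁ := S.filter fun x => Disjoint (I x) (I z) with hS₁
  set S₂ := S.filter fun x => ¬ Disjoint (I x) (I z) with hS₂
  have hcard : S.card = S₁.card + S₂.card := (Finset.card_filter_add_card_filter_not _).symm
  have hz₂ : z ∈ S₂ := by
    simp only [hS₂, Finset.mem_filter, hz, true_and, Finset.disjoint_self_iff_empty, hI]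
    simp; omega
  have hS₂card : S₂.card ≤ 5 * m := by
    -- A shift at most `m` leaves fewer than `3 * m` places for `y`, the exceptional shift fewer
    -- than `2 * m`; hence the constant 5.
    have hsub : S₂ ⊆ Finset.Ico (w + 1 - 2 * m) (w + m) ∪
        Finset.Ico (w + 1 - m - a₀) (w + m - a₀) := by
      intro y hy
      simp only [hS₂, Finset.mem_filter, Finset.not_disjoint_iff, hI, Finset.mem_Ico] at hy
      obtain ⟨hyS, i, ⟨h1, h2⟩, h3, h4⟩ := hy
      have h5 := hmax y hyS
      simp only [Finset.mem_union, Finset.mem_Ico]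
      rcases ha₀ _ (hq y) h5 with h6 | h6
      · left; omega
      · right; omega
    refine (Finset.card_le_card hsub).trans ((Finset.card_union_le _ _).trans ?_)
    simp only [Nat.card_Ico]
    omega
  have hlt : S₁.card < n := by
    have : 0 < S₂.card := Finset.card_pos.2 ⟨z, hz₂⟩
    omega
  have h1 := ih _ hlt S₁ (fun x hx => hS x (Finset.mem_filter.1 hx).1) rfl
  have hdisj : Disjoint (S₁.biUnion I) (I z) := by
    rw [Finset.disjoint_biUnion_left]
    exact fun x hx => (Finset.mem_filter.1 hx).2
  have hsub : S₁.biUnion I ∪ I z ⊆ S.biUnion I :=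
    Finset.union_subset (Finset.biUnion_subset_biUnion_of_subset_left _ (Finset.filter_subset _ _))
      (Finset.subset_biUnion_of_mem I hz)
  calc c * (n : ℝ≥0∞) = c * S₁.card + c * S₂.card := by
        rw [← h, hcard]; push_cast; ring
    _ ≤ 5 * ∑ i ∈ S₁.biUnion I, φ i + 5 * ∑ i ∈ I z, φ i := by
        refine add_le_add h1 ?_
        calc c * (S₂.card : ℝ≥0∞) ≤ c * ((5 * m : ℕ) : ℝ≥0∞) := by gcongr
          _ = 5 * (c * m) := by push_cast; ring
          _ ≤ _ := by gcongr; exact hS z hz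
    _ = 5 * ∑ i ∈ S₁.biUnion I ∪ I z, φ i := by
        rw [Finset.sum_union hdisj, mul_add]
    _ ≤ _ := by gcongr

theorem sum_Ico_iterate {X : Type*} {T : X → X} (φ : X → ℝ≥0∞) (x : X) (y a m : ℕ) :
    ∑ i ∈ Finset.Ico a (a + m), φ (T^[i] (T^[y] x)) =
      ∑ i ∈ Finset.Ico (y + a) (y + a + m), φ (T^[i] x) := by
  rw [Finset.sum_Ico_eq_sum_range, Finset.sum_Ico_eq_sum_range]
  simp only [add_tsub_cancel_left]
  refine Finset.sum_congr rfl fun i _ => ?_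
  rw [← Function.iterate_add_apply]
  congr 2; ring

/-! ### Transference to measure preserving maps -/

section Transference

variable {X : Type*} [MeasurableSpace X] {μ : Measure X} {T : X → X}

theorem lintegral_comp_iterate (hT : MeasurePreserving T μ μ) {φ : X → ℝ≥0∞} (hφ : Measurable φ)
    (i : ℕ) : ∫⁻ x, φ (T^[i] x) ∂μ = ∫⁻ x, φ x ∂μ :=
  (hT.iterate i).lintegral_comp hφ

/-- The set where some window average from `Ω` is at least `c`. -/
def windowSet (T : X → X) (φ : X → ℝ≥0∞) (c : ℝ≥0∞) (Ω : Set (ℕ × ℕ)) : Set X :=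
  {x | ∃ p ∈ Ω, c * p.2 ≤ ∑ i ∈ Finset.Ico p.1 (p.1 + p.2), φ (T^[i] x)}

theorem measurableSet_windowSet (hT : Measurable T) {φ : X → ℝ≥0∞} (hφ : Measurable φ)
    (c : ℝ≥0∞) (Ω : Set (ℕ × ℕ)) : MeasurableSet (windowSet T φ c Ω) := by
  have : windowSet T φ c Ω =
      ⋃ p ∈ Ω, {x | c * p.2 ≤ ∑ i ∈ Finset.Ico p.1 (p.1 + p.2), φ (T^[i] x)} := by
    ext x; simp [windowSet]
  rw [this]
  refine MeasurableSet.biUnion (Set.to_countable Ω) fun p _ => ?_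
  exact measurableSet_le measurable_const
    (Finset.measurable_sum _ fun i _ => hφ.comp (hT.iterate i))

/-- Calderón transference: apply the covering lemma to the orbit segment of length `R` at each point
and integrate. Windows overrun the segment by at most `K`, so the bound is `5 (R + K)` times the
integral, and the overrun disappears as `R` grows. -/
theorem SparseShifts.weak_type_of_bounded {Ω : Set (ℕ × ℕ)} (hΩ : SparseShifts Ω)
    (hT : MeasurePreserving T μ μ) {φ : X → ℝ≥0∞} (hφ : Measurable φ) (hφi : ∫⁻ x, φ x ∂μ ≠ ∞)
    (c : ℝ≥0∞) (K : ℕ) (hK : ∀ p ∈ Ω, p.1 + p.2 ≤ K) :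
    c * μ (windowSet T φ c Ω) ≤ 5 * ∫⁻ x, φ x ∂μ := by
  classical
  set E := windowSet T φ c Ω with hE
  have hEm : MeasurableSet E := measurableSet_windowSet hT.measurable hφ c Ω
  set J := ∫⁻ x, φ x ∂μ with hJ
  have key : ∀ R : ℕ, (R : ℝ≥0∞) * (c * μ E) ≤ 5 * ((R + K : ℕ) * J) := by
    intro R
    have hpt : ∀ x, c * ∑ y ∈ Finset.range R, E.indicator 1 (T^[y] x) ≤
        5 * ∑ i ∈ Finset.range (R + K), φ (T^[i] x) := by
      intro x
      rcases Ω.eq_empty_or_nonempty with rfl | ⟨p₀, hp₀⟩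
      · have : E = ∅ := by simp [hE, windowSet]
        simp [this]
      set S := (Finset.range R).filter fun y => T^[y] x ∈ E with hS
      have hex : ∀ y, ∃ p ∈ Ω, T^[y] x ∈ E →
          c * p.2 ≤ ∑ i ∈ Finset.Ico p.1 (p.1 + p.2), φ (T^[i] (T^[y] x)) := by
        intro y
        by_cases hy : T^[y] x ∈ E
        · obtain ⟨p, hp, h⟩ := hy
          exact ⟨p, hp, fun _ => h⟩
        · exact ⟨p₀, hp₀, fun h => absurd h hy⟩
      choose q hq hq' using hex
      have h1 := hΩ.covering (fun i => φ (T^[i] x)) c q hq S (by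
        intro y hy
        rw [← sum_Ico_iterate]
        exact hq' y (Finset.mem_filter.1 hy).2)
      have h2 : ∑ y ∈ Finset.range R, E.indicator (1 : X → ℝ≥0∞) (T^[y] x) = S.card := by
        simp [hS, Set.indicator_apply]
      rw [h2]
      refine h1.trans ?_
      gcongr
      intro i hi
      simp only [Finset.mem_biUnion, Finset.mem_Ico, hS, Finset.mem_filter, Finset.mem_range] at hi ⊢
      obtain ⟨y, ⟨hy, _⟩, _, h4⟩ := hi
      have := hK _ (hq y)
      omega
    have h3 := lintegral_mono (μ := μ) hpt
    have hm₁ : ∀ i, Measurable fun x => E.indicator (1 : X → ℝ≥0∞) (T^[i] x) := fun i =>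
      (measurable_one.indicator hEm).comp (hT.measurable.iterate i)
    have hm₂ : ∀ i, Measurable fun x => φ (T^[i] x) := fun i => hφ.comp (hT.measurable.iterate i)
    rw [lintegral_const_mul _ (Finset.measurable_fun_sum _ fun i _ => hm₁ i),
      lintegral_const_mul _ (Finset.measurable_fun_sum _ fun i _ => hm₂ i),
      lintegral_finsetSum _ (fun i _ => hm₁ i), lintegral_finsetSum _ (fun i _ => hm₂ i)] at h3
    simp only [lintegral_comp_iterate hT hφ,
      lintegral_comp_iterate hT (measurable_one.indicator hEm), lintegral_indicator_one hEm,
      Finset.sum_const, Finset.card_range, nsmul_eq_mul] at h3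
    calc (R : ℝ≥0∞) * (c * μ E) = c * (R * μ E) := by ring
      _ ≤ _ := h3
  have hfin : 5 * (K * J) ≠ ∞ :=
    ENNReal.mul_ne_top (by simp) (ENNReal.mul_ne_top (by simp) hφi)
  have hY : (5 : ℝ≥0∞) * J ≠ ∞ := ENNReal.mul_ne_top (by simp) hφi
  by_contra! hlt
  obtain ⟨v, hv1, hv2⟩ := exists_between hlt
  have hvtop : v ≠ ∞ := (lt_of_lt_of_le hv2 le_top).ne
  -- Archimedean form of dividing by `R` and letting it tend to infinity.
  obtain ⟨R, hR⟩ := ENNReal.exists_nat_mul_gt (tsub_pos_of_lt hv1).ne' hfin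
  have h4 := key R
  have h5 : (R : ℝ≥0∞) * v ≤ R * (5 * J) + 5 * (K * J) := by
    calc (R : ℝ≥0∞) * v ≤ R * (c * μ E) := by gcongr
      _ ≤ _ := h4
      _ = _ := by push_cast; ring
  have h6 : (R : ℝ≥0∞) * (v - 5 * J) ≤ 5 * (K * J) := by
    rw [ENNReal.mul_sub (fun _ _ => by simp)]
    exact tsub_le_iff_left.2 h5
  exact absurd hR (not_lt.2 h6)

/-- The weak type `(1, 1)` maximal inequality for sparse families of windows. -/
theorem SparseShifts.weak_type {Ω : Set (ℕ × ℕ)} (hΩ : SparseShifts Ω)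
    (hT : MeasurePreserving T μ μ) {φ : X → ℝ≥0∞} (hφ : Measurable φ) (hφi : ∫⁻ x, φ x ∂μ ≠ ∞)
    (c : ℝ≥0∞) :
    c * μ (windowSet T φ c Ω) ≤ 5 * ∫⁻ x, φ x ∂μ := by
  set W : ℕ → Set (ℕ × ℕ) := fun K => {p ∈ Ω | p.1 + p.2 ≤ K} with hW
  have hU : windowSet T φ c Ω = ⋃ K, windowSet T φ c (W K) := by
    ext x
    simp only [windowSet, Set.mem_ofPred_eq, Set.mem_iUnion, hW]
    constructor
    · rintro ⟨p, hp, h⟩; exact ⟨_, p, ⟨hp, le_rfl⟩, h⟩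
    · rintro ⟨K, p, ⟨hp, _⟩, h⟩; exact ⟨p, hp, h⟩
  have hmono : Monotone fun K => windowSet T φ c (W K) := by
    rintro K K' h x ⟨p, ⟨hp, hK⟩, hx⟩
    exact ⟨p, ⟨hp, hK.trans h⟩, hx⟩
  rw [hU, hmono.measure_iUnion, ENNReal.mul_iSup]
  refine iSup_le fun K => SparseShifts.weak_type_of_bounded ⟨fun p hp => hΩ.1 p hp.1, fun L => ?_⟩
    hT hφ hφi c K fun p hp => hp.2
  obtain ⟨a₀, h⟩ := hΩ.2 L
  exact ⟨a₀, fun p hp => h p hp.1⟩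

end Transference

/-! ### Block layouts and the maximal inequality along blocks -/

/-- Blocks `[a k, a k + l k)` separated by finite sets `D k`, with rapidly growing lengths. -/
structure BlockLayout (a l : ℕ → ℕ) (D : ℕ → Finset ℕ) : Prop where
  one_le_start : 1 ≤ a 0
  start_le_length : ∀ k, a k ≤ l k
  sq_le_length : ∀ k, (k + 1) ^ 2 ≤ l k
  end_le_start : ∀ k, a k + l k ≤ a (k + 1)
  le_pert : ∀ k, ∀ d ∈ D k, a k + l k ≤ d
  pert_lt : ∀ k, ∀ d ∈ D k, d < a (k + 1)

open Classical in
/-- The elements of the blocks below `t`. -/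
noncomputable def blockPart (a l : ℕ → ℕ) (t : ℕ) : Finset ℕ :=
  (Finset.range t).filter fun i => ∃ k, i ∈ Finset.Ico (a k) (a k + l k)

open Classical in
/-- The elements of the perturbations below `t`. -/
noncomputable def pertPart (D : ℕ → Finset ℕ) (t : ℕ) : Finset ℕ :=
  (Finset.range t).filter fun i => ∃ k, i ∈ D k

namespace BlockLayout

variable {a l : ℕ → ℕ} {D : ℕ → Finset ℕ}

theorem length_pos (h : BlockLayout a l D) (k : ℕ) : 1 ≤ l k :=
  le_trans (Nat.one_le_pow _ _ (by omega)) (h.sq_le_length k)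

theorem strictMono_start (h : BlockLayout a l D) : StrictMono a :=
  strictMono_nat_of_lt_succ fun k => by
    have := h.length_pos k; have := h.end_le_start k; omega

theorem end_le_start_of_lt (h : BlockLayout a l D) {j k : ℕ} (hjk : j < k) : a j + l j ≤ a k :=
  (h.end_le_start j).trans (h.strictMono_start.monotone hjk)

theorem start_pos (h : BlockLayout a l D) (k : ℕ) : 1 ≤ a k :=
  h.one_le_start.trans (h.strictMono_start.monotone (Nat.zero_le k))

theorem exists_stage (h : BlockLayout a l D) {t : ℕ} (ht : a 0 ≤ t) :
    ∃ k, a k ≤ t ∧ t < a (k + 1) := by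
  have hex : ∃ k, t < a k := ⟨t + 1, lt_of_lt_of_le (Nat.lt_succ_self t) h.strictMono_start.le_apply⟩
  classical
  have h1 := Nat.find_spec hex
  have h0 : Nat.find hex ≠ 0 := by
    intro h0; rw [h0] at h1; omega
  refine ⟨Nat.find hex - 1, ?_, ?_⟩
  · exact not_lt.1 (Nat.find_min hex (by omega))
  · rwa [Nat.sub_add_cancel (by omega)]

theorem blockPart_start_zero (h : BlockLayout a l D) : blockPart a l (a 0) = ∅ := by
  classical
  rw [blockPart, Finset.filter_eq_empty_iff]
  rintro i hi ⟨k, hk⟩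
  have := h.strictMono_start.monotone (Nat.zero_le k)
  simp only [Finset.mem_range, Finset.mem_Ico] at hi hk
  omega

theorem blockPart_eq_union (h : BlockLayout a l D) {k t : ℕ} (h1 : a k ≤ t) (h2 : t ≤ a (k + 1)) :
    blockPart a l t = blockPart a l (a k) ∪ Finset.Ico (a k) (a k + min (t - a k) (l k)) := by
  ext i
  simp only [blockPart, Finset.mem_filter, Finset.mem_union, Finset.mem_range, Finset.mem_Ico]
  constructor
  · rintro ⟨hi, j, hj⟩
    rcases lt_trichotomy j k with hjk | rfl | hjk
    · left
      have := h.end_le_start_of_lt hjk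
      exact ⟨by omega, j, hj⟩
    · right; omega
    · have := h.strictMono_start.monotone (show k + 1 ≤ j from hjk)
      omega
  · rintro (⟨hi, hj⟩ | hi)
    · exact ⟨by omega, hj⟩
    · exact ⟨by omega, k, by omega⟩

theorem disjoint_blockPart (k n : ℕ) :
    Disjoint (blockPart a l (a k)) (Finset.Ico (a k) n) := by
  rw [Finset.disjoint_left]
  intro i hi hi'
  simp only [blockPart, Finset.mem_filter, Finset.mem_range, Finset.mem_Ico] at hi hi'
  omega

theorem sum_blockPart {M : Type*} [AddCommMonoid M] (h : BlockLayout a l D) {k t : ℕ}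
    (h1 : a k ≤ t) (h2 : t ≤ a (k + 1)) (F : ℕ → M) :
    ∑ i ∈ blockPart a l t, F i = ∑ i ∈ blockPart a l (a k), F i +
      ∑ i ∈ Finset.Ico (a k) (a k + min (t - a k) (l k)), F i := by
  rw [h.blockPart_eq_union h1 h2, Finset.sum_union (disjoint_blockPart _ _)]

theorem card_blockPart (h : BlockLayout a l D) {k t : ℕ} (h1 : a k ≤ t) (h2 : t ≤ a (k + 1)) :
    (blockPart a l t).card = (blockPart a l (a k)).card + min (t - a k) (l k) := by
  rw [h.blockPart_eq_union h1 h2, Finset.card_union_of_disjoint (disjoint_blockPart _ _)]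
  simp

theorem sum_blockPart_start {M : Type*} [AddCommMonoid M] (h : BlockLayout a l D) (F : ℕ → M)
    (k : ℕ) : ∑ i ∈ blockPart a l (a k), F i =
      ∑ j ∈ Finset.range k, ∑ i ∈ Finset.Ico (a j) (a j + l j), F i := by
  induction k with
  | zero => simp [h.blockPart_start_zero]
  | succ k ih =>
    have := h.end_le_start k
    rw [h.sum_blockPart (h.strictMono_start.monotone (Nat.le_add_right k 1)) le_rfl, ih,
      Finset.sum_range_succ, min_eq_right (by omega)]

theorem card_blockPart_start (h : BlockLayout a l D) (k : ℕ) :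
    (blockPart a l (a k)).card = ∑ j ∈ Finset.range k, l j := by
  rw [Finset.card_eq_sum_ones, h.sum_blockPart_start]
  simp

/-- The windows controlling the block averages. -/
def windows (a l : ℕ → ℕ) : Set (ℕ × ℕ) :=
  {p | 1 ≤ p.2 ∧ (p.1 = 0 ∨ ∃ k, p.1 = a (k + 1) ∧ l k ≤ p.2)}

/-- A shift `a (k + 1)` exceeding the scale `L` while `l k ≤ L` determines `k`: for smaller indices
`j`, `a (j + 1) ≤ a k ≤ l k ≤ L`, and for larger ones `l j ≥ a j ≥ a (k + 1) > L`. This is what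
`start_le_length` is for. -/
theorem sparseShifts_windows (h : BlockLayout a l D) : SparseShifts (windows a l) := by
  refine ⟨fun p hp => hp.1, fun L => ?_⟩
  by_cases hex : ∃ k, l k ≤ L ∧ L < a (k + 1)
  · obtain ⟨k, hk1, hk2⟩ := hex
    refine ⟨a (k + 1), ?_⟩
    rintro ⟨b, m⟩ ⟨h1, h2⟩ hm
    simp only at h1 h2 hm ⊢
    rcases h2 with h2 | ⟨j, h2, h3⟩
    · left; omega
    · by_contra! hcon
      have hjk : j ≠ k := by rintro rfl; exact hcon.2 h2
      rcases lt_or_gt_of_ne hjk with hjk | hjk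
      · have h4 := h.strictMono_start.monotone (show j + 1 ≤ k from hjk)
        have h5 := h.start_le_length k
        omega
      · have h4 := h.strictMono_start.monotone (show k + 1 ≤ j from hjk)
        have h5 := h.start_le_length j
        omega
  · push Not at hex
    refine ⟨0, ?_⟩
    rintro ⟨b, m⟩ ⟨h1, h2⟩ hm
    simp only at h1 h2 hm ⊢
    rcases h2 with h2 | ⟨j, h2, h3⟩
    · left; omega
    · left; rw [h2]; exact hex j (h3.trans hm)

/-- Two windows suffice. All earlier blocks lie in `[0, a k + l k)`, of length at most `2 * l k`,
and the current block is covered by the window of length `m` at `a (k + 1)`, where `m ≥ l k` is the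
number of block elements so far. This gives `2 + 1 = 3`. -/
theorem sum_blockPart_le {X : Type*} {T : X → X} (h : BlockLayout a l D) {φ : X → ℝ≥0∞} {c : ℝ≥0∞} {x : X}
    (hx : x ∉ windowSet T φ c (windows a l)) {t : ℕ} (ht : a 1 ≤ t) :
    ∑ i ∈ blockPart a l t, φ (T^[i] x) ≤ 3 * c * (blockPart a l t).card := by
  obtain ⟨k, hk1, hk2⟩ := h.exists_stage ((h.strictMono_start.monotone (Nat.zero_le 1)).trans ht)
  obtain ⟨k, rfl⟩ : ∃ j, k = j + 1 := by
    refine Nat.exists_eq_succ_of_ne_zero ?_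
    rintro rfl; simp at hk2; omega
  simp only [windowSet, Set.mem_ofPred_eq, not_exists, not_and, not_le] at hx
  rw [h.sum_blockPart hk1 hk2.le]
  have hcard := h.card_blockPart hk1 hk2.le
  have hcard2 := h.card_blockPart_start (k + 1)
  have hl : l k ≤ (blockPart a l (a (k + 1))).card := by
    rw [hcard2, Finset.sum_range_succ]; omega
  set m := (blockPart a l t).card with hm
  have hsl := h.start_le_length k
  have hl1 := h.length_pos k
  have h1 : ∑ i ∈ blockPart a l (a (k + 1)), φ (T^[i] x) ≤ c * (2 * m) := by
    have hsub : blockPart a l (a (k + 1)) ⊆ Finset.Ico 0 (0 + (a k + l k)) := by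
      intro i hi
      simp only [blockPart, Finset.mem_filter, Finset.mem_range, Finset.mem_Ico] at hi ⊢
      obtain ⟨hi, j, hj⟩ := hi
      rcases lt_trichotomy j k with hjk | rfl | hjk
      · have := h.end_le_start_of_lt hjk; omega
      · omega
      · have := h.strictMono_start.monotone (show k + 1 ≤ j from hjk); omega
    have h2 := hx (0, a k + l k) ⟨by simp only; omega, Or.inl rfl⟩
    calc ∑ i ∈ blockPart a l (a (k + 1)), φ (T^[i] x)
        ≤ ∑ i ∈ Finset.Ico 0 (0 + (a k + l k)), φ (T^[i] x) :=
          Finset.sum_le_sum_of_subset hsub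
      _ ≤ c * ((a k + l k : ℕ) : ℝ≥0∞) := h2.le
      _ ≤ c * ((2 * m : ℕ) : ℝ≥0∞) := by gcongr; omega
      _ = _ := by push_cast; rfl
  have h2 : ∑ i ∈ Finset.Ico (a (k + 1)) (a (k + 1) + min (t - a (k + 1)) (l (k + 1))),
      φ (T^[i] x) ≤ c * m := by
    have h3 := hx (a (k + 1), m) ⟨by simp only; omega, Or.inr ⟨k, rfl, by simp only; omega⟩⟩
    refine le_trans (Finset.sum_le_sum_of_subset ?_) h3.le
    exact Finset.Ico_subset_Ico le_rfl (by simp only; omega)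
  calc _ ≤ c * (2 * m) + c * m := add_le_add h1 h2
    _ = _ := by ring

section Maximal

variable {X : Type*} [MeasurableSpace X] {μ : Measure X} {T : X → X}

/-- Weak type `(1, 1)` inequality for the block averages. -/
theorem exists_maximal_set (h : BlockLayout a l D) (hT : MeasurePreserving T μ μ)
    {φ : X → ℝ≥0∞} (hφ : Measurable φ) (hφi : ∫⁻ x, φ x ∂μ ≠ ∞) (c : ℝ≥0∞) :
    ∃ E : Set X, c * μ E ≤ 15 * ∫⁻ x, φ x ∂μ ∧ ∀ x ∉ E, ∀ t, a 1 ≤ t →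
      ∑ i ∈ blockPart a l t, φ (T^[i] x) ≤ c * (blockPart a l t).card := by
  refine ⟨windowSet T φ (c / 3) (windows a l), ?_, fun x hx t ht => ?_⟩
  · have h1 := h.sparseShifts_windows.weak_type hT hφ hφi (c / 3)
    calc c * μ (windowSet T φ (c / 3) (windows a l))
        = 3 * (c / 3 * μ (windowSet T φ (c / 3) (windows a l))) := by
          rw [← mul_assoc, ENNReal.mul_div_cancel (by simp) (by simp)]
      _ ≤ 3 * (5 * ∫⁻ x, φ x ∂μ) := by gcongr
      _ = _ := by rw [← mul_assoc]; norm_num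
  · have h1 := h.sum_blockPart_le hx ht
    rwa [ENNReal.mul_div_cancel (by simp) (by simp)] at h1

end Maximal

/-- The average of `F` over the block elements below `t`. -/
noncomputable def blockAverage (a l : ℕ → ℕ) (F : ℕ → ℝ) (t : ℕ) : ℝ :=
  (∑ i ∈ blockPart a l t, F i) / (blockPart a l t).card

/-- An error bounded per block is negligible: at stage `k + 1` it is `O(k)`, while `sq_le_length`
provides at least `(k + 1) ^ 2` block elements. -/
theorem tendsto_stage_div_card (h : BlockLayout a l D) (C : ℝ) (hC : 0 ≤ C) (F : ℕ → ℝ)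
    (hF : ∀ k t, a k ≤ t → t ≤ a (k + 1) → |F t| ≤ C * (k + 1)) :
    Tendsto (fun t => F t / (blockPart a l t).card) atTop (𝓝 0) := by
  rw [Metric.tendsto_atTop]
  intro ε hε
  obtain ⟨K, hK⟩ := exists_nat_gt (2 * C / ε)
  refine ⟨a (K + 1), fun t ht => ?_⟩
  obtain ⟨k, hk1, hk2⟩ := h.exists_stage ((h.strictMono_start.monotone (Nat.zero_le _)).trans ht)
  have hKk : K < k := by
    by_contra! hcon
    have := h.strictMono_start.monotone (show k + 1 ≤ K + 1 by omega)
    omega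
  obtain ⟨k, rfl⟩ : ∃ j, k = j + 1 := Nat.exists_eq_succ_of_ne_zero (by omega)
  have hcard := h.card_blockPart hk1 hk2.le
  have hcard2 := h.card_blockPart_start (k + 1)
  rw [Finset.sum_range_succ] at hcard2
  have hsq := h.sq_le_length k
  have hm : (k + 1) ^ 2 ≤ (blockPart a l t).card := by omega
  have hm' : ((k : ℝ) + 1) ^ 2 ≤ (blockPart a l t).card := by exact_mod_cast hm
  have hk0 : (0 : ℝ) < (k : ℝ) + 1 := by positivity
  have hpos : (0 : ℝ) < (blockPart a l t).card := lt_of_lt_of_le (by positivity) hm'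
  rw [dist_zero_right, Real.norm_eq_abs, abs_div, abs_of_pos hpos, div_lt_iff₀ hpos]
  have h1 := hF _ t hk1 hk2.le
  push_cast at h1
  have h2 : 2 * C < ε * (k + 1) := by
    have : (K : ℝ) ≤ k := by exact_mod_cast (by omega : K ≤ k)
    rw [div_lt_iff₀ hε] at hK
    nlinarith
  have hk1' : (1 : ℝ) ≤ (k : ℝ) + 1 := by
    have : (0 : ℝ) ≤ k := by positivity
    linarith
  calc |F t| ≤ C * ((k : ℝ) + 1 + 1) := h1
    _ ≤ (2 * C) * (k + 1) := by nlinarith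
    _ < (ε * (k + 1)) * (k + 1) := by gcongr
    _ = ε * ((k : ℝ) + 1) ^ 2 := by ring
    _ ≤ _ := by gcongr

/-- Block averages of bounded sequences are asymptotically shift invariant. -/
theorem tendsto_blockAverage_shift (h : BlockLayout a l D) {F : ℕ → ℝ} {C : ℝ}
    (hF : ∀ i, |F i| ≤ C) (r : ℕ) :
    Tendsto (fun t => blockAverage a l (fun i => F (i + r)) t - blockAverage a l F t)
      atTop (𝓝 0) := by
  have hC : 0 ≤ C := (abs_nonneg _).trans (hF 0)
  induction r with
  | zero => simp
  | succ r ih =>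
    have hstep : Tendsto (fun t => blockAverage a l (fun i => F (i + (r + 1))) t -
        blockAverage a l (fun i => F (i + r)) t) atTop (𝓝 0) := by
      -- The sum telescopes over an interval, so each block contributes only its two ends.
      have hI : ∀ b m, |∑ i ∈ Finset.Ico b (b + m), (F (i + (r + 1)) - F (i + r))| ≤ 2 * C := by
        intro b m
        have : ∑ i ∈ Finset.Ico b (b + m), (F (i + (r + 1)) - F (i + r)) =
            F (b + m + r) - F (b + r) := by
          rw [Finset.sum_Ico_eq_sum_range, add_tsub_cancel_left]
          have := Finset.sum_range_sub (fun i => F (b + i + r)) m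
          simp only [add_zero] at this
          rw [← this]
          refine Finset.sum_congr rfl fun i _ => ?_
          congr 2; ring
        rw [this]
        have h1 := hF (b + m + r)
        have h2 := hF (b + r)
        have := abs_sub (F (b + m + r)) (F (b + r))
        linarith
      have h0 : ∀ k, |∑ i ∈ blockPart a l (a k), (F (i + (r + 1)) - F (i + r))| ≤ 2 * C * k := by
        intro k
        rw [h.sum_blockPart_start]
        refine (Finset.abs_sum_le_sum_abs _ _).trans ?_
        refine (Finset.sum_le_card_nsmul _ _ (2 * C) fun j _ => hI _ _).trans ?_
        simp; linarith
      have := h.tendsto_stage_div_card (2 * C) (by positivity)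
        (fun t => ∑ i ∈ blockPart a l t, (F (i + (r + 1)) - F (i + r))) (by
          intro k t h1 h2
          rw [h.sum_blockPart h1 h2]
          refine (abs_add_le _ _).trans ?_
          have := h0 k
          have := hI (a k) (min (t - a k) (l k))
          linarith)
      refine this.congr fun t => ?_
      rw [Finset.sum_sub_distrib, sub_div]; rfl
    simpa using hstep.add ih

end BlockLayout

/-! ### Convergence almost everywhere along the blocks -/

section Ergodic

variable {X : Type*} [MeasurableSpace X] {μ : Measure X} {T : X → X}

/-- The Banach principle in the form needed here: for fixed `δ` the exceptional set is null since
`η` is arbitrary, and countably many `δ` give the Cauchy property. -/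
theorem ae_exists_tendsto_of_small_oscillation {u : ℕ → X → ℝ}
    (h : ∀ δ : ℝ, 0 < δ → ∀ η : ℝ≥0∞, η ≠ 0 → ∃ E : Set X, μ E ≤ η ∧
      ∀ᵐ x ∂μ, x ∉ E → ∃ L : ℝ, ∀ᶠ t in atTop, |u t x - L| ≤ δ) :
    ∀ᵐ x ∂μ, ∃ L : ℝ, Tendsto (fun t => u t x) atTop (𝓝 L) := by
  have h1 : ∀ n : ℕ, ∀ᵐ x ∂μ, ∃ L : ℝ, ∀ᶠ t in atTop, |u t x - L| ≤ 1 / ((n : ℝ) + 1) := by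
    intro n
    rw [ae_iff]
    refine le_antisymm (le_of_forall_pos_le_add fun η hη => ?_) zero_le
    obtain ⟨E, hE, hx⟩ := h (1 / ((n : ℝ) + 1)) (by positivity) η hη.ne'
    rw [zero_add]
    refine le_trans ?_ hE
    refine measure_mono_ae ?_
    filter_upwards [hx] with x hx hx'
    by_contra hcon
    exact hx' (hx hcon)
  rw [← ae_all_iff] at h1
  filter_upwards [h1] with x hx
  refine cauchySeq_tendsto_of_complete (Metric.cauchySeq_iff'.2 fun ε hε => ?_)
  obtain ⟨n, hn⟩ := exists_nat_one_div_lt (half_pos hε)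
  obtain ⟨L, hL⟩ := hx n
  obtain ⟨N, hN⟩ := eventually_atTop.1 hL
  refine ⟨N, fun m hm => ?_⟩
  have h2 := hN m hm
  have h3 := hN N le_rfl
  rw [Real.dist_eq]
  rw [abs_le] at h2 h3
  rw [abs_lt]
  constructor <;> linarith [h2.1, h2.2, h3.1, h3.2]

/-- A version of the mean ergodic theorem: the averages of a square integrable function are close
in square mean to an invariant function. -/
theorem exists_invariant_approx (hT : MeasurePreserving T μ μ) {f : X → ℝ} (hf : MemLp f 2 μ)
    {η : ℝ≥0∞} (hη : η ≠ 0) :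
    ∃ (R : ℕ) (P : X → ℝ), 1 ≤ R ∧ Measurable P ∧ P ∘ T =ᵐ[μ] P ∧
      ∫⁻ x, ENNReal.ofReal (((∑ r ∈ Finset.range R, f (T^[r] x)) / R - P x) ^ 2) ∂μ ≤ η := by
  set U := (Lp.compMeasurePreservingₗᵢ (E := ℝ) (p := 2) ℝ T hT).toContinuousLinearMap with hU
  have hU1 : ‖U‖ ≤ 1 := LinearIsometry.norm_toContinuousLinearMap_le _
  set F : Lp ℝ 2 μ := hf.toLp f with hF
  have hlim := U.tendsto_birkhoffAverage_orthogonalProjection hU1 F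
  set Q := (U.eqLocus (1 : Lp ℝ 2 μ →L[ℝ] Lp ℝ 2 μ)).orthogonalProjectionOnto F with hQ
  have hQinv : U (Q : Lp ℝ 2 μ) = Q := Q.2
  have hUapp : ∀ G : Lp ℝ 2 μ, U G = Lp.compMeasurePreserving T hT G := fun G => rfl
  obtain ⟨ζ, hζ0, hζ⟩ : ∃ ζ : ℝ≥0∞, ζ ≠ 0 ∧ ζ ^ 2 ≤ η := by
    refine ⟨min 1 η, ?_, ?_⟩
    · simp [hη]
    · calc (min 1 η) ^ 2 = min 1 η * min 1 η := sq _
        _ ≤ 1 * η := mul_le_mul' (min_le_left _ _) (min_le_right _ _)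
        _ = η := one_mul _
  have hev := (EMetric.tendsto_nhds.1 hlim ζ (pos_iff_ne_zero.2 hζ0)).and (eventually_ge_atTop 1)
  obtain ⟨R, hR, hR1⟩ := hev.exists
  obtain ⟨P, hPm, hP⟩ : ∃ P : X → ℝ, Measurable P ∧ (Q : Lp ℝ 2 μ) =ᵐ[μ] P :=
    (Lp.aestronglyMeasurable (Q : Lp ℝ 2 μ)).aemeasurable
  have hiter : ∀ r, U^[r] F = (hf.comp_measurePreserving (hT.iterate r)).toLp _ := by
    intro r
    change (Lp.compMeasurePreserving T hT)^[r] F = _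
    rw [Lp.compMeasurePreserving_iterate]
    rfl
  have hsum : ∀ n, ((∑ r ∈ Finset.range n, U^[r] F : Lp ℝ 2 μ) : X → ℝ) =ᵐ[μ]
      fun x => ∑ r ∈ Finset.range n, f (T^[r] x) := by
    intro n
    induction n with
    | zero =>
      simp only [Finset.range_zero, Finset.sum_empty]
      exact Lp.coeFn_zero ℝ 2 μ
    | succ n ih =>
      simp only [Finset.sum_range_succ]
      have h2 : (U^[n] F : X → ℝ) =ᵐ[μ] f ∘ T^[n] := by
        rw [hiter]; exact MemLp.coeFn_toLp _
      filter_upwards [Lp.coeFn_add (∑ r ∈ Finset.range n, U^[r] F) (U^[n] F), ih, h2]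
        with x h1 h3 h4
      rw [h1, Pi.add_apply, h3, h4]; rfl
  refine ⟨R, P, hR1, hPm, ?_, ?_⟩
  · have h1 := Lp.coeFn_compMeasurePreserving (Q : Lp ℝ 2 μ) hT
    rw [← hUapp, hQinv] at h1
    have h2 : (Q : Lp ℝ 2 μ) ∘ T =ᵐ[μ] P ∘ T := hT.quasiMeasurePreserving.ae_eq_comp hP
    exact (h2.symm.trans h1.symm).trans hP
  · rw [Lp.edist_def] at hR
    have h1 := eLpNorm_nnreal_pow_eq_lintegral (μ := μ) (p := 2) two_ne_zero
      (f := ⇑(birkhoffAverage ℝ U _root_.id R F) - ⇑(Q : Lp ℝ 2 μ))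
    simp only [NNReal.coe_ofNat, ENNReal.rpow_ofNat, ENNReal.coe_ofNat] at h1
    have h2 : ∫⁻ x, ENNReal.ofReal (((∑ r ∈ Finset.range R, f (T^[r] x)) / R - P x) ^ 2) ∂μ =
        ∫⁻ x, ‖(⇑(birkhoffAverage ℝ U _root_.id R F) - ⇑(Q : Lp ℝ 2 μ)) x‖ₑ ^ 2 ∂μ := by
      refine lintegral_congr_ae ?_
      have h3 : birkhoffAverage ℝ U _root_.id R F =
          (R : ℝ)⁻¹ • ∑ r ∈ Finset.range R, U^[r] F := rfl
      rw [h3]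
      filter_upwards [hsum R, hP, Lp.coeFn_smul (R : ℝ)⁻¹ (∑ r ∈ Finset.range R, U^[r] F)]
        with x h4 h5 h6
      rw [Pi.sub_apply, h6, Pi.smul_apply, h4, h5, Real.enorm_eq_ofReal_abs,
        ← ENNReal.ofReal_pow (abs_nonneg _), sq_abs, smul_eq_mul, div_eq_inv_mul]
    rw [h2, ← h1]
    exact le_trans (pow_le_pow_left' hR.le 2) hζ

theorem ae_forall_iterate_eq (hT : MeasurePreserving T μ μ) {P : X → ℝ}
    (hP : P ∘ T =ᵐ[μ] P) : ∀ᵐ x ∂μ, ∀ i : ℕ, P (T^[i] x) = P x := by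
  rw [ae_all_iff]
  intro i
  induction i with
  | zero => simp
  | succ i ih =>
    filter_upwards [ih, (hT.iterate i).quasiMeasurePreserving.ae_eq_comp hP] with x h1 h2
    rw [← h1, Function.iterate_succ_apply']
    exact h2

theorem BlockLayout.exists_maximal_set_real {a l : ℕ → ℕ} {D : ℕ → Finset ℕ}
    (h : BlockLayout a l D) (hT : MeasurePreserving T μ μ)
    {ψ : X → ℝ} (hψ : Measurable ψ) (hψ0 : ∀ x, 0 ≤ ψ x) {c : ℝ} (hc : 0 < c) {η : ℝ≥0∞}
    (hη : η ≠ ∞) (hψi : 15 * ∫⁻ x, ENNReal.ofReal (ψ x) ∂μ ≤ ENNReal.ofReal c * η) :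
    ∃ E : Set X, μ E ≤ η ∧ ∀ x ∉ E, ∀ t, a 1 ≤ t →
      ∑ i ∈ blockPart a l t, ψ (T^[i] x) ≤ c * (blockPart a l t).card := by
  have hfin : ∫⁻ x, ENNReal.ofReal (ψ x) ∂μ ≠ ∞ := by
    intro h1
    rw [h1, ENNReal.mul_top (by simp)] at hψi
    exact (ENNReal.mul_lt_top ENNReal.ofReal_lt_top hη.lt_top).not_ge hψi
  obtain ⟨E, hE, hx⟩ := h.exists_maximal_set hT hψ.ennreal_ofReal hfin (ENNReal.ofReal c)
  refine ⟨E, ?_, fun x hxE t ht => ?_⟩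
  · have h1 := hE.trans hψi
    rwa [ENNReal.mul_le_mul_iff_right (by simpa using hc) ENNReal.ofReal_ne_top] at h1
  · have h1 := hx x hxE t ht
    rw [← ENNReal.ofReal_sum_of_nonneg (fun i _ => hψ0 _), ← ENNReal.ofReal_natCast,
      ← ENNReal.ofReal_mul hc.le] at h1
    exact (ENNReal.ofReal_le_ofReal_iff (by positivity)).1 h1

theorem abs_div_card_le {s : Finset ℕ} {F G : ℕ → ℝ} {c : ℝ} (hs : s.Nonempty)
    (hFG : ∀ i, |F i| ≤ G i) (hG : ∑ i ∈ s, G i ≤ c * s.card) :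
    |(∑ i ∈ s, F i) / s.card| ≤ c := by
  have hpos : (0 : ℝ) < s.card := by exact_mod_cast hs.card_pos
  rw [abs_div, abs_of_pos hpos, div_le_iff₀ hpos]
  exact (Finset.abs_sum_le_sum_abs _ _).trans ((Finset.sum_le_sum fun i _ => hFG i).trans hG)

theorem BlockLayout.blockPart_nonempty {a l : ℕ → ℕ} {D : ℕ → Finset ℕ}
    (h : BlockLayout a l D) {t : ℕ} (ht : a 1 ≤ t) : (blockPart a l t).Nonempty := by
  classical
  refine ⟨a 0, ?_⟩
  have := h.end_le_start 0
  have := h.length_pos 0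
  simp only [blockPart, Finset.mem_filter, Finset.mem_range, Finset.mem_Ico]
  exact ⟨by simp at *; omega, 0, by omega⟩

/-- The averages of an integrable function along the blocks converge almost everywhere. -/
theorem BlockLayout.ae_tendsto_blockAverage {a l : ℕ → ℕ} {D : ℕ → Finset ℕ}
    (h : BlockLayout a l D) (hT : MeasurePreserving T μ μ) {f : X → ℝ} (hfm : Measurable f)
    (hf : Integrable f μ) :
    ∀ᵐ x ∂μ, ∃ L : ℝ, Tendsto (fun t => blockAverage a l (fun i => f (T^[i] x)) t) atTop (𝓝 L) := by
  refine ae_exists_tendsto_of_small_oscillation fun δ' hδ' η' hη' => ?_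
  -- The budget: `δ` for `f - g`, `δ` for replacing `g` by its ergodic average `A`, and `2 * δ` for
  -- `A - P`.
  obtain ⟨δ, hδ, rfl⟩ : ∃ δ : ℝ, 0 < δ ∧ δ' = 4 * δ := ⟨δ' / 4, by positivity, by ring⟩
  obtain ⟨η, hη0, hηtop, hη⟩ : ∃ η : ℝ≥0∞, η ≠ 0 ∧ η ≠ ∞ ∧ η + η ≤ η' := by
    refine ⟨min 1 (η' / 2), ?_, ?_, ?_⟩
    · simp [hη']
    · exact ((min_le_left _ _).trans_lt ENNReal.one_lt_top).ne
    · calc _ ≤ η' / 2 + η' / 2 := add_le_add (min_le_right _ _) (min_le_right _ _)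
        _ = η' := ENNReal.add_halves η'
  have hmul : ∀ c : ℝ, 0 < c → ENNReal.ofReal c * η / 15 ≠ 0 := fun c hc => by
    simp only [ne_eq, ENNReal.div_eq_zero_iff, mul_eq_zero, ENNReal.ofReal_eq_zero, not_or, not_le]
    exact ⟨⟨hc, hη0⟩, by simp⟩
  have hcancel : ∀ c : ℝ, 15 * (ENNReal.ofReal c * η / 15) = ENNReal.ofReal c * η := fun c =>
    ENNReal.mul_div_cancel (by simp) (by simp)
  obtain ⟨g, hg1, hg2⟩ := (memLp_one_iff_integrable.2 hf).exists_simpleFunc_eLpNorm_sub_lt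
    ENNReal.one_ne_top (hmul δ hδ)
  obtain ⟨C, hC⟩ := g.exists_forall_norm_le
  have hgL2 : MemLp g 2 μ :=
    (SimpleFunc.memLp_iff_integrable two_ne_zero ENNReal.ofNat_ne_top).2
      (memLp_one_iff_integrable.1 hg2)
  obtain ⟨R, P, hR, hPm, hPinv, hPapp⟩ :=
    exists_invariant_approx hT hgL2 (hmul (δ ^ 2) (by positivity))
  set A : X → ℝ := fun x => (∑ r ∈ Finset.range R, g (T^[r] x)) / R with hA
  have hAm : Measurable A := (Finset.measurable_fun_sum _ fun r _ =>
    g.measurable.comp (hT.measurable.iterate r)).div_const _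
  obtain ⟨E₁, hE₁, hx₁⟩ := h.exists_maximal_set_real hT (ψ := fun x => |f x - g x|)
    ((hfm.sub g.measurable).abs) (fun x => abs_nonneg _) hδ hηtop (by
      rw [← hcancel]
      gcongr
      rw [eLpNorm_one_eq_lintegral_enorm] at hg1
      refine le_trans (le_of_eq ?_) hg1.le
      refine lintegral_congr fun x => ?_
      rw [Real.enorm_eq_ofReal_abs]; rfl)
  -- On an infinite measure space `A - P` is controlled only in square mean, so the maximal
  -- inequality is applied to its square.
  obtain ⟨E₂, hE₂, hx₂⟩ := h.exists_maximal_set_real hT (ψ := fun x => (A x - P x) ^ 2)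
    ((hAm.sub hPm).pow_const 2) (fun x => sq_nonneg _) (pow_pos hδ 2) hηtop (by
      rw [← hcancel]
      gcongr)
  refine ⟨E₁ ∪ E₂, (measure_union_le _ _).trans ((add_le_add hE₁ hE₂).trans hη), ?_⟩
  filter_upwards [ae_forall_iterate_eq hT hPinv] with x hPx hxE
  rw [Set.mem_union, not_or] at hxE
  refine ⟨P x, ?_⟩
  have hshift : Tendsto (fun t => blockAverage a l (fun i => A (T^[i] x)) t -
      blockAverage a l (fun i => g (T^[i] x)) t) atTop (𝓝 0) := by
    have h1 : ∀ r, Tendsto (fun t => blockAverage a l (fun i => g (T^[i + r] x)) t -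
        blockAverage a l (fun i => g (T^[i] x)) t) atTop (𝓝 0) := fun r =>
      h.tendsto_blockAverage_shift (F := fun i => g (T^[i] x)) (fun i => hC _) r
    have h2 := (tendsto_finsetSum (Finset.range R) fun r _ => h1 r).div_const (R : ℝ)
    simp only [Finset.sum_const_zero, zero_div] at h2
    refine h2.congr fun t => ?_
    have hR0 : (R : ℝ) ≠ 0 := by positivity
    rw [Finset.sum_sub_distrib, sub_div, Finset.sum_const, Finset.card_range, nsmul_eq_mul,
      mul_div_cancel_left₀ _ hR0]
    congr 1
    simp only [blockAverage, hA]
    rw [← Finset.sum_div, ← Finset.sum_div, Finset.sum_comm, div_right_comm]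
    simp only [← Function.iterate_add_apply, add_comm]
  have hev := (Metric.tendsto_nhds.1 hshift δ hδ).and (eventually_ge_atTop (a 1))
  filter_upwards [hev] with t ht
  obtain ⟨ht1, ht2⟩ := ht
  rw [dist_zero_right, Real.norm_eq_abs] at ht1
  have hne := h.blockPart_nonempty ht2
  have hpos : (0 : ℝ) < (blockPart a l t).card := by exact_mod_cast hne.card_pos
  have b1 : |blockAverage a l (fun i => f (T^[i] x) - g (T^[i] x)) t| ≤ δ :=
    abs_div_card_le hne (fun i => le_rfl) (hx₁ x hxE.1 t ht2)
  have b2 : |blockAverage a l (fun i => A (T^[i] x) - P (T^[i] x)) t| ≤ 2 * δ := by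
    -- The elementary bound `|r| ≤ δ + r ^ 2 / δ` turns the control of the squares into control of
    -- the average.
    refine abs_div_card_le (G := fun i => δ + (A (T^[i] x) - P (T^[i] x)) ^ 2 / δ) hne
      (fun i => ?_) ?_
    · set r := A (T^[i] x) - P (T^[i] x)
      rw [← sub_nonneg, ← mul_nonneg_iff_of_pos_left hδ]
      have : δ * (δ + r ^ 2 / δ - |r|) = δ ^ 2 + |r| ^ 2 - δ * |r| := by
        rw [sq_abs]; field_simp
      rw [this]
      nlinarith [sq_nonneg (δ - |r|), abs_nonneg r]
    · rw [Finset.sum_add_distrib, ← Finset.sum_div, Finset.sum_const, nsmul_eq_mul]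
      have h3 := hx₂ x hxE.2 t ht2
      have h4 : (∑ i ∈ blockPart a l t, (A (T^[i] x) - P (T^[i] x)) ^ 2) / δ ≤
          δ * (blockPart a l t).card := by
        rw [div_le_iff₀ hδ]; linarith
      linarith
  have b3 : blockAverage a l (fun i => P (T^[i] x)) t = P x := by
    simp only [blockAverage, hPx, Finset.sum_const, nsmul_eq_mul]
    field_simp
  have e1 : blockAverage a l (fun i => f (T^[i] x) - g (T^[i] x)) t =
      blockAverage a l (fun i => f (T^[i] x)) t - blockAverage a l (fun i => g (T^[i] x)) t := by
    simp only [blockAverage, Finset.sum_sub_distrib, sub_div]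
  have e2 : blockAverage a l (fun i => A (T^[i] x) - P (T^[i] x)) t =
      blockAverage a l (fun i => A (T^[i] x)) t - blockAverage a l (fun i => P (T^[i] x)) t := by
    simp only [blockAverage, Finset.sum_sub_distrib, sub_div]
  rw [e1, abs_le] at b1
  rw [e2, b3, abs_le] at b2
  rw [abs_lt] at ht1
  rw [abs_le]
  constructor <;> linarith [b1.1, b1.2, b2.1, b2.2, ht1.1, ht1.2]

end Ergodic

/-! ### Comparing full averages with block averages -/

namespace BlockLayout

variable {a l : ℕ → ℕ} {D : ℕ → Finset ℕ}

theorem pairwiseDisjoint_pert (h : BlockLayout a l D) (s : Set ℕ) : s.PairwiseDisjoint D := by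
  have key : ∀ j k, j < k → Disjoint (D j) (D k) := by
    intro j k hjk
    rw [Finset.disjoint_left]
    intro d hd hd'
    have h1 := h.pert_lt j d hd
    have h2 := h.le_pert k d hd'
    have h3 := h.strictMono_start.monotone (show j + 1 ≤ k from hjk)
    omega
  intro j _ k _ hjk
  rcases lt_or_gt_of_ne hjk with h1 | h1
  · exact key j k h1
  · exact (key k j h1).symm

theorem sum_pertPart_le (h : BlockLayout a l D) {ψ : ℕ → ℝ} (hψ : ∀ i, 0 ≤ ψ i) {t K : ℕ}
    (ht : t ≤ a K + l K) :
    ∑ i ∈ pertPart D t, ψ i ≤ ∑ j ∈ Finset.range K, ∑ i ∈ D j, ψ i := by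
  rw [← Finset.sum_biUnion (h.pairwiseDisjoint_pert _)]
  refine Finset.sum_le_sum_of_subset_of_nonneg ?_ fun i _ _ => hψ i
  intro i hi
  simp only [pertPart, Finset.mem_filter, Finset.mem_range, Finset.mem_biUnion] at hi ⊢
  obtain ⟨hi, j, hj⟩ := hi
  refine ⟨j, ?_, hj⟩
  by_contra! hK
  have h1 := h.le_pert j i hj
  rcases hK.eq_or_lt with rfl | hK
  · omega
  · have := h.end_le_start_of_lt hK
    omega

/-- A Stolz–Cesàro argument: sums over `D k` that are `o(l k)` add up to `o` of the summed lengths.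
-/
theorem tendsto_sum_pertPart_div (h : BlockLayout a l D) {ψ : ℕ → ℝ} (hψ : ∀ i, 0 ≤ ψ i)
    (hlim : Tendsto (fun k => (∑ d ∈ D k, ψ d) / l k) atTop (𝓝 0)) :
    Tendsto (fun t => (∑ i ∈ pertPart D t, ψ i) / (blockPart a l t).card) atTop (𝓝 0) := by
  have hlpos : ∀ k, (1 : ℝ) ≤ l k := fun k => by exact_mod_cast h.length_pos k
  have ho : (fun k => ∑ d ∈ D k, ψ d) =o[atTop] fun k => (l k : ℝ) :=
    (Asymptotics.isLittleO_iff_tendsto fun k hk => by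
      have := hlpos k; rw [hk] at this; norm_num at this).2 hlim
  have htop : Tendsto (fun K => ∑ j ∈ Finset.range K, (l j : ℝ)) atTop atTop := by
    refine tendsto_atTop_mono (fun K => ?_) tendsto_natCast_atTop_atTop
    calc (K : ℝ) = ∑ j ∈ Finset.range K, (1 : ℝ) := by simp
      _ ≤ _ := Finset.sum_le_sum fun j _ => hlpos j
  have hρ := (ho.sum_range (fun k => by positivity) htop).tendsto_div_nhds_zero
  rw [Metric.tendsto_atTop] at hρ ⊢
  intro ε hε
  obtain ⟨K, hK⟩ := hρ ε hε
  refine ⟨a (K + 1), fun t ht => ?_⟩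
  obtain ⟨k, hk1, hk2⟩ := h.exists_stage ((h.strictMono_start.monotone (Nat.zero_le _)).trans ht)
  have hKk : K < k := by
    by_contra! hcon
    have := h.strictMono_start.monotone (show k + 1 ≤ K + 1 by omega)
    omega
  have hcard := h.card_blockPart hk1 hk2.le
  -- Inside block `k` only earlier perturbations occur, so `j = k`; beyond its end part of `D k` may
  -- occur, but all of `l k` is already counted, so `j = k + 1`.
  obtain ⟨j, hKj, hj0, htj, hcj⟩ : ∃ j, K ≤ j ∧ 0 < j ∧ t ≤ a j + l j ∧
      ∑ i ∈ Finset.range j, l i ≤ (blockPart a l t).card := by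
    rcases le_or_gt t (a k + l k) with h1 | h1
    · refine ⟨k, hKk.le, by omega, h1, ?_⟩
      rw [hcard, h.card_blockPart_start]; omega
    · refine ⟨k + 1, by omega, by omega, by omega, ?_⟩
      rw [hcard, h.card_blockPart_start, Finset.sum_range_succ]; omega
  have h1 := hK j hKj
  have hcj' : ∑ i ∈ Finset.range j, (l i : ℝ) ≤ (blockPart a l t).card := by exact_mod_cast hcj
  have hpos : (0 : ℝ) < ∑ i ∈ Finset.range j, (l i : ℝ) :=
    Finset.sum_pos (fun i _ => lt_of_lt_of_le one_pos (hlpos i)) ⟨0, by simpa using hj0⟩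
  have hs0 : 0 ≤ ∑ i ∈ pertPart D t, ψ i := Finset.sum_nonneg fun i _ => hψ i
  have hs := h.sum_pertPart_le hψ htj
  rw [dist_zero_right, Real.norm_eq_abs] at h1 ⊢
  rw [abs_of_nonneg (div_nonneg hs0 (by positivity))]
  refine lt_of_le_of_lt ?_ (lt_of_le_of_lt (le_abs_self _) h1)
  gcongr
  exact hs0.trans hs

theorem disjoint_blockPart_pertPart (h : BlockLayout a l D) (t : ℕ) :
    Disjoint (blockPart a l t) (pertPart D t) := by
  rw [Finset.disjoint_left]
  intro i hi hi'
  simp only [blockPart, pertPart, Finset.mem_filter, Finset.mem_range, Finset.mem_Ico] at hi hi'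
  obtain ⟨_, j, hj⟩ := hi
  obtain ⟨_, k, hk⟩ := hi'
  have h1 := h.le_pert k i hk
  have h2 := h.pert_lt k i hk
  rcases lt_trichotomy j k with hjk | rfl | hjk
  · have := h.end_le_start_of_lt hjk; omega
  · omega
  · have := h.strictMono_start.monotone (show k + 1 ≤ j from hjk); omega

theorem sum_range_comp (h : BlockLayout a l D) {n : ℕ → ℕ} (hn : StrictMono n)
    (hr : Set.range n = {m | ∃ k, m ∈ Finset.Ico (a k) (a k + l k) ∪ D k}) (F : ℕ → ℝ) {M t : ℕ}
    (hM : ∀ i, n i < t ↔ i < M) :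
    ∑ k ∈ Finset.range M, F (n k) =
      ∑ i ∈ blockPart a l t, F i + ∑ i ∈ pertPart D t, F i := by
  have himage : (Finset.range M).map ⟨n, hn.injective⟩ = blockPart a l t ∪ pertPart D t := by
    ext m
    have hm : m ∈ Set.range n ↔ m ∈ {m | ∃ k, m ∈ Finset.Ico (a k) (a k + l k) ∪ D k} := by
      rw [hr]
    simp only [Set.mem_range, Set.mem_ofPred_eq, Finset.mem_union] at hm
    simp only [Finset.mem_map, Finset.mem_range, Function.Embedding.coeFn_mk, Finset.mem_union,
      blockPart, pertPart, Finset.mem_filter]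
    rw [← and_or_left, ← exists_or, ← hm]
    constructor
    · rintro ⟨i, hi, rfl⟩; exact ⟨(hM i).2 hi, i, rfl⟩
    · rintro ⟨hi, i, rfl⟩; exact ⟨i, (hM i).1 hi, rfl⟩
  rw [← Finset.sum_union (h.disjoint_blockPart_pertPart _), ← himage, Finset.sum_map]
  rfl

/-- Negligible perturbations do not affect the convergence of averages along the blocks. -/
theorem tendsto_average (h : BlockLayout a l D) {n : ℕ → ℕ} (hn : StrictMono n)
    (hr : Set.range n = {m | ∃ k, m ∈ Finset.Ico (a k) (a k + l k) ∪ D k}) {F : ℕ → ℝ} {L : ℝ}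
    (hcard : Tendsto (fun k => ((D k).card : ℝ) / l k) atTop (𝓝 0))
    (hD : Tendsto (fun k => (∑ d ∈ D k, |F d|) / l k) atTop (𝓝 0))
    (hB : Tendsto (blockAverage a l F) atTop (𝓝 L)) :
    Tendsto (fun N : ℕ => 1 / (N : ℝ) * ∑ k ∈ Finset.range N, F (n k)) atTop (𝓝 L) := by
  have h1 := h.tendsto_sum_pertPart_div (ψ := fun _ => 1) (fun _ => zero_le_one)
    (by simpa using hcard)
  have h2 := h.tendsto_sum_pertPart_div (ψ := fun i => |F i|) (fun _ => abs_nonneg _) hD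
  have h3 : Tendsto (fun t => (∑ i ∈ pertPart D t, F i) / (blockPart a l t).card)
      atTop (𝓝 0) := by
    refine squeeze_zero_norm (fun t => ?_) h2
    rw [Real.norm_eq_abs, abs_div, Nat.abs_cast]
    gcongr
    exact Finset.abs_sum_le_sum_abs _ _
  have h4 : Tendsto (fun t => (blockAverage a l F t +
      (∑ i ∈ pertPart D t, F i) / (blockPart a l t).card) /
      (1 + (∑ i ∈ pertPart D t, (1 : ℝ)) / (blockPart a l t).card)) atTop (𝓝 L) := by
    have := (hB.add h3).div (h1.const_add 1) (by norm_num)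
    simp only [add_zero, div_one] at this
    exact this
  refine (h4.comp hn.tendsto_atTop).congr' ?_
  have hev := (hn.tendsto_atTop.eventually_ge_atTop (a 1))
  filter_upwards [hev] with N hN
  have hne : (0 : ℝ) < (blockPart a l (n N)).card := by
    exact_mod_cast (h.blockPart_nonempty hN).card_pos
  have hN' : (N : ℝ) = (blockPart a l (n N)).card + ∑ i ∈ pertPart D (n N), (1 : ℝ) := by
    have := h.sum_range_comp hn hr (fun _ => 1) fun i => hn.lt_iff_lt (a := i) (b := N)
    simpa using this
  simp only [Function.comp, blockAverage]
  rw [h.sum_range_comp hn hr F fun i => hn.lt_iff_lt (a := i) (b := N), hN', ← add_div]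
  have h5 : 1 + (∑ i ∈ pertPart D (n N), (1 : ℝ)) / (blockPart a l (n N)).card =
      ((blockPart a l (n N)).card + ∑ i ∈ pertPart D (n N), (1 : ℝ)) /
        (blockPart a l (n N)).card := by
    field_simp
  rw [h5, div_div_div_cancel_right₀ hne.ne']
  ring

/-- If the averages converge then the contributions of the perturbations are negligible. -/
theorem tendsto_pert_of_tendsto_average (h : BlockLayout a l D) {n : ℕ → ℕ} (hn : StrictMono n)
    (hr : Set.range n = {m | ∃ k, m ∈ Finset.Ico (a k) (a k + l k) ∪ D k}) {F : ℕ → ℝ} {L : ℝ}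
    (hcard : Tendsto (fun k => ((D k).card : ℝ) / l k) atTop (𝓝 0))
    (hA : Tendsto (fun N : ℕ => 1 / (N : ℝ) * ∑ k ∈ Finset.range N, F (n k)) atTop (𝓝 L)) :
    Tendsto (fun k => (∑ d ∈ D k, F d) / l k) atTop (𝓝 0) := by
  have hex : ∀ t, ∃ M, ∀ i, n i < t ↔ i < M := fun t => by
    classical
    have h1 : ∃ M, t ≤ n M := ⟨t, hn.le_apply⟩
    refine ⟨Nat.find h1, fun i => ⟨fun hi => ?_, fun hi => not_le.1 (Nat.find_min h1 hi)⟩⟩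
    by_contra! hcon
    have := (Nat.find_spec h1).trans (hn.monotone hcon)
    omega
  -- `M k` and `M' k` count the terms just before and just after `D k`; the difference of the two
  -- partial sums isolates the sum over `D k`.
  choose M hM using fun k => hex (a k + l k)
  choose M' hM' using fun k => hex (a (k + 1))
  have hsum : ∀ (G : ℕ → ℝ) k, ∑ i ∈ Finset.range (M' k), G (n i) =
      ∑ i ∈ Finset.range (M k), G (n i) + ∑ i ∈ D k, G i := by
    intro G k
    have h2 := h.end_le_start k
    rw [h.sum_range_comp hn hr G (hM' k), h.sum_range_comp hn hr G (hM k),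
      h.sum_blockPart (h.strictMono_start.monotone (Nat.le_add_right k 1)) le_rfl,
      h.sum_blockPart (k := k) (by omega) h2, min_eq_right (by omega), min_eq_right (by omega)]
    have h3 : pertPart D (a (k + 1)) = pertPart D (a k + l k) ∪ D k := by
      classical
      ext i
      simp only [pertPart, Finset.mem_filter, Finset.mem_range, Finset.mem_union]
      constructor
      · rintro ⟨hi, j, hj⟩
        rcases lt_trichotomy j k with hjk | rfl | hjk
        · left
          have := h.pert_lt j i hj
          have := h.strictMono_start.monotone (show j + 1 ≤ k from hjk)
          exact ⟨by omega, j, hj⟩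
        · exact Or.inr hj
        · have := h.le_pert j i hj
          have := h.strictMono_start.monotone (show k + 1 ≤ j from hjk)
          omega
      · rintro (⟨hi, hj⟩ | hi)
        · exact ⟨by omega, hj⟩
        · exact ⟨h.pert_lt k i hi, k, hi⟩
    have h4 : Disjoint (pertPart D (a k + l k)) (D k) := by
      rw [Finset.disjoint_left]
      intro i hi hi'
      simp only [pertPart, Finset.mem_filter, Finset.mem_range] at hi
      have := h.le_pert k i hi'
      omega
    rw [h3, Finset.sum_union h4]
    ring
  have hMcard : ∀ k, (M' k : ℝ) = M k + (D k).card := fun k => by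
    simpa using hsum (fun _ => 1) k
  -- Multiplying `A (M' k) - A (M k)` by `M k / l k` is harmless: only integers below `a k + l k ≤ 2
  -- * l k` are counted.
  have hMle : ∀ k, M k ≤ 2 * l k := fun k => by
    have h1 := h.start_le_length k
    by_contra! hcon
    have h2 := (hM k (2 * l k)).2 hcon
    have := hn.le_apply (x := 2 * l k)
    omega
  have hleM : ∀ k, l k ≤ M k := fun k => by
    have h1 := h.sum_range_comp hn hr (fun _ => 1) (hM k)
    rw [h.sum_blockPart (k := k) (by omega) (h.end_le_start k), min_eq_right (by omega)] at h1
    simp only [Finset.sum_const, Finset.card_range, nsmul_eq_mul, mul_one, Nat.card_Ico,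
      add_tsub_cancel_left] at h1
    norm_cast at h1
    omega
  have hlk : ∀ k, k ≤ l k := fun k => by
    have := h.sq_le_length k
    nlinarith
  have hMtop : Tendsto M atTop atTop :=
    tendsto_atTop_mono (fun k => (hlk k).trans (hleM k)) tendsto_id
  have hMtop' : Tendsto M' atTop atTop := by
    refine tendsto_atTop_mono (fun k => ?_) hMtop
    have : (M k : ℝ) ≤ M' k := by rw [hMcard]; simp
    exact_mod_cast this
  set A : ℕ → ℝ := fun N => 1 / (N : ℝ) * ∑ k ∈ Finset.range N, F (n k) with hAdef
  have h1 : Tendsto (fun k => A (M' k) - A (M k)) atTop (𝓝 0) := by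
    simpa using (hA.comp hMtop').sub (hA.comp hMtop)
  have h2 : Tendsto (fun k => (M k : ℝ) / l k * (A (M' k) - A (M k))) atTop (𝓝 0) := by
    have h3 := h1.norm.const_mul 2
    rw [norm_zero, mul_zero] at h3
    refine squeeze_zero_norm (fun k => ?_) h3
    rw [norm_mul]
    gcongr
    have hl : (0 : ℝ) < l k := by exact_mod_cast h.length_pos k
    rw [Real.norm_eq_abs, abs_of_nonneg (by positivity), div_le_iff₀ hl]
    exact_mod_cast hMle k
  have h3 : Tendsto (fun k => (M k : ℝ) / l k * (A (M' k) - A (M k)) +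
      ((D k).card : ℝ) / l k * A (M' k)) atTop (𝓝 0) := by
    simpa using h2.add (hcard.mul (hA.comp hMtop'))
  refine h3.congr fun k => ?_
  have hl : (0 : ℝ) < l k := by exact_mod_cast h.length_pos k
  have hMpos : (0 : ℝ) < M k := lt_of_lt_of_le hl (by exact_mod_cast hleM k)
  have hMpos' : (0 : ℝ) < M' k := by rw [hMcard]; positivity
  have e1 : ∑ i ∈ Finset.range (M' k), F (n i) = M' k * A (M' k) := by
    simp only [hAdef]; field_simp
  have e2 : ∑ i ∈ Finset.range (M k), F (n i) = M k * A (M k) := by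
    simp only [hAdef]; field_simp
  have h5 := hsum F k
  rw [e1, e2, hMcard] at h5
  have h6 : ∑ d ∈ D k, F d = M k * (A (M' k) - A (M k)) + (D k).card * A (M' k) := by linarith
  rw [h6]
  ring

end BlockLayout

/-! ### Negligibility of perturbations -/

section Perturbation

variable {X : Type*} [MeasurableSpace X] {μ : Measure X} {T : X → X}

/-- Perturbations of relative size `c k` are negligible for functions of class `L Log^p L` if the
partial sums of `c` up to `u ^ 2` are bounded by `(log u) ^ p`. -/
theorem ae_tendsto_pert {l : ℕ → ℕ} {D : ℕ → Finset ℕ} {c : ℕ → ℝ} {p : ℝ}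
    (hl : ∀ k, 1 ≤ l k) (hc : ∀ k, 0 ≤ c k) (hD : ∀ k, ((D k).card : ℝ) ≤ c k * l k)
    (hc₀ : Tendsto (fun k : ℕ => c k * √k) atTop (𝓝 0)) {C : ℝ}
    (hcsum : ∀ u : ℝ, 0 ≤ u → ∀ K : ℕ, ∑ k ∈ (Finset.range K).filter (fun k : ℕ => √(k : ℝ) < u), c k ≤
      C * (1 + Real.log (u + 1) ^ p))
    (hT : MeasurePreserving T μ μ) {f : X → ℝ} (hfm : Measurable f) (hf : MemLLogL p f μ) :
    ∀ᵐ x ∂μ, Tendsto (fun k => (∑ d ∈ D k, |f (T^[d] x)|) / l k) atTop (𝓝 0) := by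
  set F : ℕ → X → ℝ := fun k x => if √(k : ℝ) < |f x| then |f x| else 0 with hF
  have hF0 : ∀ k x, 0 ≤ F k x := fun k x => by simp only [hF]; split_ifs <;> positivity
  have hFm : ∀ k, Measurable (F k) := fun k =>
    Measurable.ite (measurableSet_lt measurable_const hfm.abs) hfm.abs measurable_const
  set G : ℕ → X → ℝ := fun k x => (∑ d ∈ D k, F k (T^[d] x)) / l k with hG
  have hlpos : ∀ k, (0 : ℝ) < l k := fun k => by exact_mod_cast hl k
  have hGm : ∀ k, Measurable (G k) := fun k =>
    (Finset.measurable_fun_sum _ fun d _ => (hFm k).comp (hT.measurable.iterate d)).div_const _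
  have hGint : ∀ k, ∫⁻ x, ENNReal.ofReal (G k x) ∂μ ≤
      ∫⁻ x, ENNReal.ofReal (c k * F k x) ∂μ := by
    intro k
    have h1 : ∀ x, ENNReal.ofReal (G k x) =
        ENNReal.ofReal (l k : ℝ)⁻¹ * ∑ d ∈ D k, ENNReal.ofReal (F k (T^[d] x)) := fun x => by
      rw [← ENNReal.ofReal_sum_of_nonneg fun _ _ => hF0 _ _, ← ENNReal.ofReal_mul (by positivity)]
      simp only [hG]; rw [div_eq_inv_mul]
    have h2 : ∀ d, Measurable fun x => ENNReal.ofReal (F k (T^[d] x)) := fun d =>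
      ((hFm k).comp (hT.measurable.iterate d)).ennreal_ofReal
    simp only [h1]
    rw [lintegral_const_mul _ (Finset.measurable_fun_sum _ fun d _ => h2 d),
      lintegral_finsetSum _ fun d _ => h2 d]
    simp only [lintegral_comp_iterate hT (hFm k).ennreal_ofReal, Finset.sum_const, nsmul_eq_mul,
      ENNReal.ofReal_mul (hc k)]
    rw [lintegral_const_mul _ (hFm k).ennreal_ofReal, ← mul_assoc]
    gcongr
    rw [← ENNReal.ofReal_natCast, ← ENNReal.ofReal_mul (by positivity)]
    apply ENNReal.ofReal_le_ofReal
    rw [inv_mul_le_iff₀ (hlpos k), mul_comm]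
    exact hD k
  -- Summing over `k` before integrating: only indices with `√k < |f x|` survive, which is where the
  -- hypothesis on the partial sums of `c` enters.
  have hbound : ∀ x, ∑' k, ENNReal.ofReal (c k * F k x) ≤
      ENNReal.ofReal (C * (|f x| + |f x| * Real.log (|f x| + 1) ^ p)) := by
    intro x
    rw [ENNReal.tsum_eq_iSup_nat]
    refine iSup_le fun K => ?_
    rw [← ENNReal.ofReal_sum_of_nonneg fun k _ => mul_nonneg (hc k) (hF0 k x)]
    apply ENNReal.ofReal_le_ofReal
    have h1 := mul_le_mul_of_nonneg_right (hcsum |f x| (abs_nonneg _) K) (abs_nonneg (f x))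
    calc ∑ k ∈ Finset.range K, c k * F k x =
        (∑ k ∈ (Finset.range K).filter (fun k : ℕ => √(k : ℝ) < |f x|), c k) * |f x| := by
          rw [Finset.sum_filter, Finset.sum_mul]
          refine Finset.sum_congr rfl fun k _ => ?_
          simp only [hF]; split_ifs <;> simp
      _ ≤ _ := h1
      _ = _ := by ring
  have hfin : ∫⁻ x, ∑' k, ENNReal.ofReal (G k x) ∂μ ≠ ∞ := by
    rw [lintegral_tsum fun k => (hGm k).ennreal_ofReal.aemeasurable]
    refine ne_top_of_le_ne_top ?_ (ENNReal.tsum_le_tsum hGint)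
    rw [← lintegral_tsum fun k => ((hFm k).const_mul (c k)).ennreal_ofReal.aemeasurable]
    refine ne_top_of_le_ne_top ?_ (lintegral_mono hbound)
    have hint : Integrable (fun x => C * (|f x| + |f x| * Real.log (|f x| + 1) ^ p)) μ :=
      (hf.1.abs.add hf.2).const_mul C
    exact ((lintegral_ofReal_le_lintegral_enorm _).trans_lt hint.2).ne
  have hae := ae_lt_top' (AEMeasurable.tsum fun k => (hGm k).ennreal_ofReal.aemeasurable) hfin
  filter_upwards [hae] with x hx
  have h1 := ENNReal.tendsto_atTop_zero_of_tsum_ne_top hx.ne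
  have hG0 : ∀ k, 0 ≤ G k x := fun k => div_nonneg (Finset.sum_nonneg fun _ _ => hF0 _ _)
    (hlpos k).le
  have h2 : Tendsto (fun k => G k x) atTop (𝓝 0) := by
    have := (ENNReal.tendsto_toReal ENNReal.zero_ne_top).comp h1
    simpa [Function.comp_def, ENNReal.toReal_ofReal (hG0 _)] using this
  have h3 := hc₀.add h2
  rw [add_zero] at h3
  refine squeeze_zero (fun k => by positivity) (fun k => ?_) h3
  rw [div_le_iff₀ (hlpos k)]
  have h4 : ∀ d, |f (T^[d] x)| ≤ √k + F k (T^[d] x) := fun d => by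
    simp only [hF]
    split_ifs with h5
    · have := Real.sqrt_nonneg (k : ℝ); linarith
    · push Not at h5; linarith
  have h5 : G k x * l k = ∑ d ∈ D k, F k (T^[d] x) := by
    simp only [hG]; rw [div_mul_cancel₀ _ (hlpos k).ne']
  calc ∑ d ∈ D k, |f (T^[d] x)| ≤ ∑ d ∈ D k, (√k + F k (T^[d] x)) :=
        Finset.sum_le_sum fun d _ => h4 d
    _ = (D k).card * √k + G k x * l k := by
        rw [Finset.sum_add_distrib, h5, Finset.sum_const, nsmul_eq_mul]
    _ ≤ (c k * l k) * √k + G k x * l k := by gcongr; exact hD k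
    _ = _ := by ring

/-- Perturbed block sequences with small perturbations are universally good. -/
theorem isUniversallyGoodLLogL_of_layout {a l : ℕ → ℕ} {D : ℕ → Finset ℕ} {c : ℕ → ℝ} {p : ℝ}
    (h : BlockLayout a l D) (hc : ∀ k, 0 ≤ c k) (hD : ∀ k, ((D k).card : ℝ) ≤ c k * l k)
    (hcard : Tendsto (fun k => ((D k).card : ℝ) / l k) atTop (𝓝 0))
    (hc₀ : Tendsto (fun k : ℕ => c k * √k) atTop (𝓝 0)) {C : ℝ}
    (hcsum : ∀ u : ℝ, 0 ≤ u → ∀ K : ℕ, ∑ k ∈ (Finset.range K).filter (fun k : ℕ => √(k : ℝ) < u), c k ≤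
      C * (1 + Real.log (u + 1) ^ p))
    {n : ℕ → ℕ} (hn : StrictMono n)
    (hr : Set.range n = {m | ∃ k, m ∈ Finset.Ico (a k) (a k + l k) ∪ D k}) :
    IsUniversallyGoodLLogL.{u} p n := by
  intro X _ μ T hsys f hf
  have hT := hsys.measurePreserving
  obtain ⟨g, hgm, hfg⟩ := hf.1.aestronglyMeasurable.aemeasurable
  have hg : MemLLogL p g μ := by
    refine ⟨hf.1.congr hfg, hf.2.congr ?_⟩
    filter_upwards [hfg] with x hx
    rw [hx]
  have hiter : ∀ᵐ x ∂μ, ∀ i : ℕ, f (T^[i] x) = g (T^[i] x) :=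
    ae_all_iff.2 fun i => (hT.iterate i).quasiMeasurePreserving.ae_eq_comp hfg
  filter_upwards [hiter, ae_tendsto_pert h.length_pos hc hD hc₀ hcsum hT hgm hg,
    h.ae_tendsto_blockAverage hT hgm hg.1] with x hx h1 ⟨L, h2⟩
  refine ⟨L, ?_⟩
  have h3 := h.tendsto_average hn hr (F := fun i => g (T^[i] x)) hcard h1 h2
  simpa only [subseqAverage, hx] using h3

end Perturbation

/-! ### Size of the ratios `c_k` -/

theorem one_lt_log_natCast {k : ℕ} (hk : 3 ≤ k) : 1 < Real.log k := by
  have h3 : (3 : ℝ) ≤ k := by exact_mod_cast hk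
  rw [Real.lt_log_iff_exp_lt (by linarith)]
  exact Real.exp_one_lt_three.trans_le h3

theorem ratioSeq_eq {s : ℝ} {k : ℕ} (hk : 3 ≤ k) :
    ratioSeq s k = Real.log k ^ (s - 1) * Real.log (Real.log k) ^ (s + 1) / k := by
  have h1 := one_lt_log_natCast hk
  have h2 := Real.log_pos h1
  rw [ratioSeq, levelSeq, Real.rpow_add_one h2.ne', div_div_eq_mul_div]
  ring

theorem abs_ratioSeq_le {s p : ℝ} (hs : 0 < s) (hp : s < p) :
    ∃ C : ℝ, 0 < C ∧ ∀ k : ℕ, 3 ≤ k → |ratioSeq s k| ≤ C * (Real.log k ^ (p - 1) / k) := by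
  -- Chosen so that `log y ≤ y ^ e / e`, raised to the power `s + 1`, costs exactly `y ^ (p - s)`.
  set e := (p - s) / (s + 1) with he
  have he0 : 0 < e := div_pos (by linarith) (by linarith)
  refine ⟨(e ^ (s + 1))⁻¹, by positivity, fun k hk => ?_⟩
  have h1 := one_lt_log_natCast hk
  have h2 := Real.log_pos h1
  have hx : 0 < Real.log k := by linarith
  have h3 : Real.log (Real.log k) ^ (s + 1) ≤ (e ^ (s + 1))⁻¹ * Real.log k ^ (p - s) := by
    calc Real.log (Real.log k) ^ (s + 1) ≤ (Real.log k ^ e / e) ^ (s + 1) := by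
          apply Real.rpow_le_rpow h2.le (Real.log_le_rpow_div hx.le he0) (by linarith)
      _ = (e ^ (s + 1))⁻¹ * Real.log k ^ (p - s) := by
          rw [Real.div_rpow (by positivity) he0.le, ← Real.rpow_mul hx.le, he,
            div_mul_cancel₀ _ (by linarith), div_eq_inv_mul]
  rw [ratioSeq_eq hk, abs_of_nonneg (by positivity)]
  calc Real.log k ^ (s - 1) * Real.log (Real.log k) ^ (s + 1) / k
      ≤ Real.log k ^ (s - 1) * ((e ^ (s + 1))⁻¹ * Real.log k ^ (p - s)) / k := by gcongr
    _ = (e ^ (s + 1))⁻¹ * (Real.log k ^ (s - 1) * Real.log k ^ (p - s) / k) := by ring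
    _ = _ := by rw [← Real.rpow_add hx, show s - 1 + (p - s) = p - 1 by ring]

/-- Integral comparison made telescoping by the mean value theorem for `log ^ p` on `[j, j + 1]`.
The factor `2 ^ |p - 1|` absorbs the ratio of the logarithms, at most 2, when `p ≥ 1`. -/
theorem log_rpow_div_le_sub {p : ℝ} (hp : 0 < p) :
    ∃ C : ℝ, 0 < C ∧ ∀ j : ℕ, 3 ≤ j → Real.log (j + 1 : ℕ) ^ (p - 1) / (j + 1 : ℕ) ≤
      C * (Real.log (j + 1 : ℕ) ^ p - Real.log j ^ p) := by
  refine ⟨2 ^ |p - 1| / p, by positivity, fun j hj => ?_⟩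
  have h3 : (3 : ℝ) ≤ j := by exact_mod_cast hj
  have hlog := one_lt_log_natCast hj
  push_cast
  obtain ⟨ξ, ⟨hξ1, hξ2⟩, hξ⟩ := exists_hasDerivAt_eq_slope (fun x => Real.log x ^ p)
    (fun x => x⁻¹ * p * Real.log x ^ (p - 1)) (show (j : ℝ) < j + 1 by linarith)
    (by
      refine ContinuousOn.rpow_const (Real.continuousOn_log.mono ?_) fun x _ => Or.inr hp.le
      intro x hx; simp only [Set.mem_Icc] at hx
      simp only [Set.mem_compl_iff, Set.mem_singleton_iff]; linarith)
    (by
      intro x hx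
      have hx0 : 0 < x := by linarith [hx.1]
      have hxl : 0 < Real.log x := Real.log_pos (by linarith [hx.1])
      exact (Real.hasDerivAt_log hx0.ne').rpow_const (Or.inl hxl.ne'))
  have hξ0 : 0 < ξ := by linarith
  have hlξ : Real.log j ≤ Real.log ξ := Real.log_le_log (by linarith) hξ1.le
  have hlξ' : Real.log ξ ≤ Real.log (j + 1) := Real.log_le_log hξ0 hξ2.le
  have hhalf : Real.log (j + 1) ≤ 2 * Real.log ξ := by
    have : Real.log (j + 1) ≤ Real.log ((j : ℝ) ^ 2) := Real.log_le_log (by linarith) (by nlinarith)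
    rw [Real.log_pow] at this
    push_cast at this
    linarith
  have hl0 : 0 < Real.log ξ := by linarith
  have hl1 : 0 < Real.log (j + 1) := by linarith
  have hratio : Real.log (j + 1) ^ (p - 1) ≤ 2 ^ |p - 1| * Real.log ξ ^ (p - 1) := by
    rcases le_total 1 p with h | h
    · rw [abs_of_nonneg (by linarith), ← Real.mul_rpow (by norm_num) hl0.le]
      exact Real.rpow_le_rpow hl1.le hhalf (by linarith)
    · have h1 : Real.log (j + 1) ^ (p - 1) ≤ Real.log ξ ^ (p - 1) :=
        Real.rpow_le_rpow_of_nonpos hl0 hlξ' (by linarith)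
      have h2 : (1 : ℝ) ≤ 2 ^ |p - 1| := Real.one_le_rpow (by norm_num) (abs_nonneg _)
      have h4 : 0 < Real.log ξ ^ (p - 1) := by positivity
      nlinarith
  rw [add_sub_cancel_left, div_one] at hξ
  rw [← hξ]
  have hinv : ((j : ℝ) + 1)⁻¹ ≤ ξ⁻¹ := by gcongr
  calc Real.log (j + 1) ^ (p - 1) / (j + 1) = ((j : ℝ) + 1)⁻¹ * Real.log (j + 1) ^ (p - 1) := by
        rw [div_eq_inv_mul]
    _ ≤ ξ⁻¹ * (2 ^ |p - 1| * Real.log ξ ^ (p - 1)) := by gcongr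
    _ = _ := by field_simp

theorem sum_abs_ratioSeq_le {s p : ℝ} (hs : 0 < s) (hp : s < p) :
    ∃ C : ℝ, ∀ u : ℝ, 0 ≤ u → ∀ K : ℕ,
      ∑ k ∈ (Finset.range K).filter (fun k : ℕ => √(k : ℝ) < u), |ratioSeq s (k + 1)| ≤
        C * (1 + Real.log (u + 1) ^ p) := by
  have hp0 : 0 < p := hs.trans hp
  obtain ⟨C₁, hC₁, h1⟩ := abs_ratioSeq_le hs hp
  obtain ⟨C₂, hC₂, h2⟩ := log_rpow_div_le_sub hp0
  set c : ℕ → ℝ := fun k => |ratioSeq s (k + 1)| with hc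
  set C₀ := ∑ k ∈ Finset.range 3, c k with hC₀
  have hc0 : ∀ k, 0 ≤ c k := fun k => abs_nonneg _
  have hC₀' : 0 ≤ C₀ := Finset.sum_nonneg fun k _ => hc0 k
  have hsum3 : ∀ J : ℕ, 3 ≤ J → ∑ k ∈ Finset.range J, c k ≤ C₀ + C₁ * C₂ * Real.log J ^ p := by
    intro J hJ
    induction J, hJ using Nat.le_induction with
    | base =>
      have := one_lt_log_natCast (le_refl 3)
      have : 0 ≤ C₁ * C₂ * Real.log (3 : ℕ) ^ p := by positivity
      linarith
    | succ j hj ih =>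
      rw [Finset.sum_range_succ]
      have h3 := h1 (j + 1) (by omega)
      have h4 := mul_le_mul_of_nonneg_left (h2 j hj) hC₁.le
      have h5 : c j ≤ C₁ * (C₂ * (Real.log (j + 1 : ℕ) ^ p - Real.log j ^ p)) := h3.trans h4
      linarith
  have hsum : ∀ J : ℕ, 1 ≤ J → ∑ k ∈ Finset.range J, c k ≤ C₀ + C₁ * C₂ * Real.log J ^ p := by
    intro J hJ
    rcases le_or_gt 3 J with h | h
    · exact hsum3 J h
    · have h3 : ∑ k ∈ Finset.range J, c k ≤ C₀ :=
        Finset.sum_le_sum_of_subset_of_nonneg (Finset.range_mono h.le) fun k _ _ => hc0 k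
      have : 0 ≤ Real.log J := Real.log_nonneg (by exact_mod_cast hJ)
      have : 0 ≤ C₁ * C₂ * Real.log J ^ p := by positivity
      linarith
  refine ⟨C₀ + C₁ * C₂ * 2 ^ p, fun u hu K => ?_⟩
  have hlog : 0 ≤ Real.log (u + 1) := Real.log_nonneg (by linarith)
  -- The condition `√k < u` means `k < u ^ 2`, and `J ≤ (u + 1) ^ 2`, so the logarithm at most
  -- doubles; hence the factor `2 ^ p`.
  set J := max 1 ⌈u ^ 2⌉₊ with hJ
  have hsub : (Finset.range K).filter (fun k : ℕ => √(k : ℝ) < u) ⊆ Finset.range J := by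
    intro k hk
    rw [Finset.mem_filter] at hk
    rw [Finset.mem_range, hJ]
    have h3 : (k : ℝ) < u ^ 2 := (Real.sqrt_lt' (lt_of_le_of_lt (Real.sqrt_nonneg _) hk.2)).1 hk.2
    have h4 : (k : ℝ) < ⌈u ^ 2⌉₊ := h3.trans_le (Nat.le_ceil _)
    exact lt_max_of_lt_right (by exact_mod_cast h4)
  refine (Finset.sum_le_sum_of_subset_of_nonneg hsub fun k _ _ => hc0 k).trans ?_
  refine (hsum J (le_max_left _ _)).trans ?_
  have hJ1' : 1 ≤ J := le_max_left _ _
  have hJ1 : (1 : ℝ) ≤ J := by exact_mod_cast hJ1'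
  have hJu : (J : ℝ) ≤ (u + 1) ^ 2 := by
    have := Nat.ceil_lt_add_one (sq_nonneg u)
    rw [hJ, Nat.cast_max, max_le_iff]
    push_cast
    constructor <;> nlinarith
  have hJlog : Real.log J ≤ 2 * Real.log (u + 1) := by
    have := Real.log_le_log (by linarith) hJu
    rwa [Real.log_pow] at this
  have hpow : Real.log J ^ p ≤ 2 ^ p * Real.log (u + 1) ^ p := by
    rw [← Real.mul_rpow (by norm_num) hlog]
    exact Real.rpow_le_rpow (Real.log_nonneg hJ1) hJlog hp0.le
  have h5 : 0 ≤ Real.log (u + 1) ^ p := by positivity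
  have h6 : 0 ≤ C₁ * C₂ * 2 ^ p := by positivity
  have h7 := mul_le_mul_of_nonneg_left hpow (mul_pos hC₁ hC₂).le
  have h8 : 0 ≤ C₀ * Real.log (u + 1) ^ p := by positivity
  linarith

theorem tendsto_abs_ratioSeq_mul_sqrt {s : ℝ} (hs : 0 < s) :
    Tendsto (fun k : ℕ => |ratioSeq s (k + 1)| * √k) atTop (𝓝 0) := by
  obtain ⟨C, hC, h1⟩ := abs_ratioSeq_le hs (lt_add_one s)
  have h2 : Tendsto (fun x : ℝ => Real.log x ^ s / x ^ (1 / 2 : ℝ)) atTop (𝓝 0) :=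
    (isLittleO_log_rpow_rpow_atTop s (by norm_num)).tendsto_div_nhds_zero
  have h3 := ((h2.comp tendsto_natCast_atTop_atTop).comp (tendsto_add_atTop_nat 1)).const_mul C
  rw [mul_zero] at h3
  refine squeeze_zero' (Eventually.of_forall fun k => by positivity) ?_ h3
  filter_upwards [eventually_ge_atTop 2] with k hk
  have h4 := h1 (k + 1) (by omega)
  have hk0 : (0 : ℝ) < (k + 1 : ℕ) := by positivity
  have h5 : √(k : ℝ) ≤ √((k + 1 : ℕ) : ℝ) := Real.sqrt_le_sqrt (by push_cast; linarith)
  have h6 := one_lt_log_natCast (show 3 ≤ k + 1 by omega)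
  rw [add_sub_cancel_right] at h4
  calc |ratioSeq s (k + 1)| * √k
      ≤ (C * (Real.log (k + 1 : ℕ) ^ s / (k + 1 : ℕ))) * √((k + 1 : ℕ) : ℝ) := by gcongr
    _ = C * (Real.log (k + 1 : ℕ) ^ s * (√((k + 1 : ℕ) : ℝ) / (k + 1 : ℕ))) := by ring
    _ = C * (Real.log (k + 1 : ℕ) ^ s / √((k + 1 : ℕ) : ℝ)) := by
        rw [Real.sqrt_div_self, div_eq_mul_inv (Real.log (k + 1 : ℕ) ^ s)]
    _ = _ := by rw [Real.sqrt_eq_rpow]; rfl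

theorem tendsto_abs_ratioSeq {s : ℝ} (hs : 0 < s) :
    Tendsto (fun k : ℕ => |ratioSeq s (k + 1)|) atTop (𝓝 0) := by
  refine squeeze_zero' (Eventually.of_forall fun k => abs_nonneg _) ?_
    (tendsto_abs_ratioSeq_mul_sqrt hs)
  filter_upwards [eventually_ge_atTop 1] with k hk
  exact le_mul_of_one_le_right (abs_nonneg _) (Real.one_le_sqrt.2 (by exact_mod_cast hk))

/-! ### The function `g_s` and its primitive -/

/-- The formula defining `g_s` on its support. -/
noncomputable def gCore (s x : ℝ) : ℝ :=
  (Real.log (Real.log (2 / x)) + 1) /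
    (x / 2 * Real.log (2 / x) ^ (s + 1) * Real.log (Real.log (2 / x)) ^ (s + 1))

/-- A primitive of `gCore s`. -/
noncomputable def gPrim (s x : ℝ) : ℝ :=
  2 / s * (Real.log (2 / x) * Real.log (Real.log (2 / x))) ^ (-s)

theorem gFun_of_mem {s ε x : ℝ} (hx : x ∈ Set.Ioc 0 ε) : gFun s ε x = gCore s x := by
  rw [gFun, Set.indicator_of_mem (Set.Ioc_subset_Icc_self hx)]; rfl

theorem gFun_of_lt {s ε x : ℝ} (hx : ε < x) : gFun s ε x = 0 := by
  rw [gFun, Set.indicator_of_notMem fun h => h.2.not_gt hx]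

theorem log_gt_one_of {y : ℝ} (h : 0 < Real.log y) (h' : 0 < Real.log (Real.log y)) :
    1 < Real.log y := (Real.log_pos_iff h.le).1 h'

theorem log_two_div_anti {x y : ℝ} (hx : 0 < x) (hxy : x ≤ y) :
    Real.log (2 / y) ≤ Real.log (2 / x) :=
  Real.log_le_log (by have := hx.trans_le hxy; positivity) (by gcongr)

theorem hasDerivAt_log_two_div {x : ℝ} (hx : 0 < x) :
    HasDerivAt (fun x : ℝ => Real.log (2 / x)) (-x⁻¹) x := by
  have h1 : HasDerivAt (fun x : ℝ => Real.log 2 - Real.log x) (-x⁻¹) x :=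
    (Real.hasDerivAt_log hx.ne').const_sub _
  refine h1.congr_of_eventuallyEq ?_
  filter_upwards [lt_mem_nhds hx] with y hy
  rw [Real.log_div two_ne_zero hy.ne']

theorem hasDerivAt_gPrim {s x : ℝ} (hs : s ≠ 0) (hx : 0 < x) (hL : 0 < Real.log (2 / x))
    (hM : 0 < Real.log (Real.log (2 / x))) : HasDerivAt (gPrim s) (gCore s x) x := by
  have h1 := hasDerivAt_log_two_div hx
  have h2 := h1.log hL.ne'
  have h12 : HasDerivAt (fun y : ℝ => Real.log (2 / y) * Real.log (Real.log (2 / y)))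
      (-x⁻¹ * Real.log (Real.log (2 / x)) + Real.log (2 / x) * (-x⁻¹ / Real.log (2 / x))) x :=
    h1.mul h2
  have h3 := (h12.rpow_const (p := -s) (Or.inl (mul_pos hL hM).ne')).const_mul (2 / s)
  refine HasDerivAt.congr_deriv h3 ?_
  unfold gCore
  set L := Real.log (2 / x)
  set M := Real.log L
  rw [show -s - 1 = -(s + 1) by ring, Real.rpow_neg (by positivity),
    Real.mul_rpow hL.le hM.le]
  have : L ^ (s + 1) ≠ 0 := by positivity
  have : M ^ (s + 1) ≠ 0 := by positivity
  field_simp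
  ring

theorem tendsto_log_two_div : Tendsto (fun x : ℝ => Real.log (2 / x)) (𝓝[>] 0) atTop := by
  refine Real.tendsto_log_atTop.comp ?_
  exact (tendsto_inv_nhdsGT_zero.const_mul_atTop two_pos).congr fun x => (div_eq_mul_inv _ _).symm

theorem tendsto_gPrim {s : ℝ} (hs : 0 < s) : Tendsto (gPrim s) (𝓝[>] 0) (𝓝 0) := by
  have h1 := tendsto_log_two_div
  have h2 := h1.atTop_mul_atTop₀ (Real.tendsto_log_atTop.comp h1)
  have h3 := ((tendsto_rpow_neg_atTop hs).comp h2).const_mul (2 / s)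
  rw [mul_zero] at h3
  exact h3

/-- A nonnegative derivative of a function tending to a limit at `0` is integrable. -/
theorem integrableOn_Ioc_of_hasDerivAt {F F' : ℝ → ℝ} {ε : ℝ}
    (hF : ∀ x ∈ Set.Ioc 0 ε, HasDerivAt F (F' x) x) (hF' : ∀ x ∈ Set.Ioc 0 ε, 0 ≤ F' x)
    (hlim : Tendsto F (𝓝[>] 0) (𝓝 0)) : IntegrableOn F' (Set.Ioc 0 ε) := by
  -- The value of `F` at 0 may be arbitrary, so it is replaced by the limit.
  have hcont : ContinuousOn (Function.update F 0 0) (Set.Icc 0 ε) := by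
    intro x hx
    rcases hx.1.eq_or_lt with rfl | hx0
    · rw [continuousWithinAt_update_same]
      refine hlim.mono_left (nhdsWithin_mono _ ?_)
      rintro y ⟨hy, hy'⟩
      exact lt_of_le_of_ne hy.1 (Ne.symm hy')
    · exact ((hF x ⟨hx0, hx.2⟩).continuousAt.congr (by
        filter_upwards [lt_mem_nhds hx0] with y hy
        rw [Function.update_of_ne hy.ne'])).continuousWithinAt
  refine intervalIntegral.integrableOn_deriv_of_nonneg hcont (fun x hx => ?_)
    fun x hx => hF' x ⟨hx.1, hx.2.le⟩
  refine (hF x ⟨hx.1, hx.2.le⟩).congr_of_eventuallyEq ?_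
  filter_upwards [lt_mem_nhds hx.1] with y hy
  rw [Function.update_of_ne hy.ne']

/-! ### Admissible cutoffs and integrability of `g_s` -/

section Cutoff

variable {ε : ℝ}

theorem gCore_pos {s x : ℝ} (hx : 0 < x) (hL : 0 < Real.log (2 / x))
    (hM : 0 < Real.log (Real.log (2 / x))) : 0 < gCore s x := by
  rw [gCore]; positivity

theorem gFun_nonneg {s : ℝ} (h1 : ∀ x ∈ Set.Ioc 0 ε, 0 < Real.log (2 / x))
    (h2 : ∀ x ∈ Set.Ioc 0 ε, 0 < Real.log (Real.log (2 / x))) {x : ℝ} (hx : 0 ≤ x) :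
    0 ≤ gFun s ε x := by
  rcases hx.eq_or_lt with rfl | hx
  · rw [gFun]; simp [Set.indicator_apply]
  · rcases le_or_gt x ε with h | h
    · rw [gFun_of_mem ⟨hx, h⟩]; exact (gCore_pos hx (h1 x ⟨hx, h⟩) (h2 x ⟨hx, h⟩)).le
    · rw [gFun_of_lt h]

/-- In the variable `u = log (2 / x)` the denominator is `exp (-u) * u ^ (s + 1) * (log u) ^ (s +
1)`. Passing from `u` to `v ≥ u`, each of `u` and `log u` grows at most by the factor `exp ((v - u)
/ u)`; once `u ≥ 2 * (s + 1)` the exponential decay wins. The bound `u ≥ e` makes `log u / u`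
decreasing, which controls `log u`. -/
theorem exists_isAdmissibleCutoff {s : ℝ} (hs : 0 < s) : ∃ ε, IsAdmissibleCutoff s ε := by
  set u₀ := max (Real.exp 1) (2 * (s + 1)) with hu₀
  have he : Real.exp 1 ≤ u₀ := le_max_left _ _
  have hs₀ : 2 * (s + 1) ≤ u₀ := le_max_right _ _
  have hlog : ∀ x ∈ Set.Ioc 0 (2 * Real.exp (-u₀)), u₀ ≤ Real.log (2 / x) := by
    intro x hx
    have h1 := log_two_div_anti hx.1 hx.2
    rwa [div_mul_eq_div_div, div_self two_ne_zero, one_div, ← Real.exp_neg, neg_neg,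
      Real.log_exp] at h1
  have he0 := Real.exp_pos 1
  have h1 : ∀ x ∈ Set.Ioc 0 (2 * Real.exp (-u₀)), 0 < Real.log (2 / x) := fun x hx => by
    have := hlog x hx; linarith
  have h2 : ∀ x ∈ Set.Ioc 0 (2 * Real.exp (-u₀)), 0 < Real.log (Real.log (2 / x)) := fun x hx => by
    have h3 := hlog x hx
    apply Real.log_pos
    have : (1 : ℝ) < Real.exp 1 := Real.one_lt_exp_iff.2 one_pos
    linarith
  refine ⟨2 * Real.exp (-u₀), by positivity, h1, h2, ?_⟩
  intro x hx y hy hxy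
  rcases lt_or_ge (2 * Real.exp (-u₀)) y with hyε | hyε
  · rw [gFun_of_lt hyε]
    exact gFun_nonneg h1 h2 hx.1.le
  have hxm : x ∈ Set.Ioc 0 (2 * Real.exp (-u₀)) := ⟨hx.1, hxy.trans hyε⟩
  have hym : y ∈ Set.Ioc 0 (2 * Real.exp (-u₀)) := ⟨hy.1, hyε⟩
  rw [gFun_of_mem hxm, gFun_of_mem hym, gCore, gCore]
  have hexp : ∀ z : ℝ, 0 < z → z / 2 = Real.exp (-Real.log (2 / z)) := fun z hz => by
    rw [Real.exp_neg, Real.exp_log (by positivity), inv_div]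
  rw [hexp x hx.1, hexp y hy.1]
  have hu := hlog y hym
  have huv := log_two_div_anti hx.1 hxy
  have hu1 := h1 y hym
  have hu2 := h2 y hym
  have hv1 := h1 x hxm
  have hv2 := h2 x hxm
  set u := Real.log (2 / y)
  set v := Real.log (2 / x)
  have hluv : Real.log u ≤ Real.log v := Real.log_le_log hu1 huv
  have hdiv : Real.log v * u ≤ Real.log u * v := by
    have := Real.log_div_self_antitoneOn (Set.mem_ofPred_eq ▸ he.trans hu)
      (Set.mem_ofPred_eq ▸ (he.trans hu).trans huv) huv
    rwa [div_le_div_iff₀ hv1 hu1] at this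
  have hvu : v ≤ u * Real.exp ((v - u) / u) := by
    have := Real.add_one_le_exp ((v - u) / u)
    calc v = u * ((v - u) / u + 1) := by field_simp; ring
      _ ≤ _ := by gcongr
  have hlv : Real.log v ≤ Real.log u * Real.exp ((v - u) / u) := by
    rw [← mul_le_mul_iff_left₀ hu1]
    calc Real.log v * u ≤ Real.log u * v := hdiv
      _ ≤ Real.log u * (u * Real.exp ((v - u) / u)) := by gcongr
      _ = _ := by ring
  have hmain : Real.exp (-v) * v ^ (s + 1) * Real.log v ^ (s + 1) ≤
      Real.exp (-u) * u ^ (s + 1) * Real.log u ^ (s + 1) := by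
    have hvp : v ^ (s + 1) ≤ (u * Real.exp ((v - u) / u)) ^ (s + 1) :=
      Real.rpow_le_rpow hv1.le hvu (by linarith)
    have hlvp : Real.log v ^ (s + 1) ≤ (Real.log u * Real.exp ((v - u) / u)) ^ (s + 1) :=
      Real.rpow_le_rpow hv2.le hlv (by linarith)
    rw [Real.mul_rpow hu1.le (Real.exp_pos _).le, ← Real.exp_mul] at hvp
    rw [Real.mul_rpow hu2.le (Real.exp_pos _).le, ← Real.exp_mul] at hlvp
    have hE : Real.exp (-v) * (Real.exp ((v - u) / u * (s + 1)) * Real.exp ((v - u) / u * (s + 1)))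
        ≤ Real.exp (-u) := by
      rw [← Real.exp_add, ← Real.exp_add, Real.exp_le_exp]
      have h5 : (v - u) / u * (2 * (s + 1)) ≤ v - u := by
        rw [div_mul_eq_mul_div, div_le_iff₀ hu1]
        exact mul_le_mul_of_nonneg_left (hs₀.trans hu) (by linarith)
      linarith
    calc Real.exp (-v) * v ^ (s + 1) * Real.log v ^ (s + 1)
        ≤ Real.exp (-v) * (u ^ (s + 1) * Real.exp ((v - u) / u * (s + 1))) *
          (Real.log u ^ (s + 1) * Real.exp ((v - u) / u * (s + 1))) := by gcongr
      _ = (Real.exp (-v) * (Real.exp ((v - u) / u * (s + 1)) *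
          Real.exp ((v - u) / u * (s + 1)))) * u ^ (s + 1) * Real.log u ^ (s + 1) := by ring
      _ ≤ _ := by gcongr
  gcongr

end Cutoff

theorem measurable_gCore (s : ℝ) : Measurable (gCore s) := by
  unfold gCore
  fun_prop

namespace IsAdmissibleCutoff

variable {s ε : ℝ}

theorem lt_one (h : IsAdmissibleCutoff s ε) : ε < 1 := by
  have h1 := log_gt_one_of (h.log_pos ε ⟨h.pos, le_rfl⟩) (h.log_log_pos ε ⟨h.pos, le_rfl⟩)
  rw [Real.lt_log_iff_exp_lt (by have := h.pos; positivity), lt_div_iff₀ h.pos] at h1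
  have h2 := Real.add_one_le_exp 1
  have h3 := h.pos
  nlinarith

theorem integrableOn_gCore (h : IsAdmissibleCutoff s ε) {q : ℝ} (hq : 0 < q) :
    IntegrableOn (gCore q) (Set.Ioc 0 ε) :=
  integrableOn_Ioc_of_hasDerivAt
    (fun x hx => hasDerivAt_gPrim hq.ne' hx.1 (h.log_pos x hx) (h.log_log_pos x hx))
    (fun x hx => (gCore_pos hx.1 (h.log_pos x hx) (h.log_log_pos x hx)).le) (tendsto_gPrim hq)

theorem integrableOn_inv_mul_log_log (h : IsAdmissibleCutoff s ε) {q : ℝ} (hq : 1 < q) :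
    IntegrableOn (fun x => (x * (Real.log (2 / x) * Real.log (Real.log (2 / x)) ^ q))⁻¹)
      (Set.Ioc 0 ε) := by
  refine integrableOn_Ioc_of_hasDerivAt
    (F := fun x => (q - 1)⁻¹ * Real.log (Real.log (2 / x)) ^ (-(q - 1)))
    (fun x hx => ?_) (fun x hx => ?_) ?_
  · have hL := h.log_pos x hx
    have hM := h.log_log_pos x hx
    have hx0 := hx.1
    have h1 := (((hasDerivAt_log_two_div hx0).log hL.ne').rpow_const (p := -(q - 1))
      (Or.inl hM.ne')).const_mul (q - 1)⁻¹
    refine h1.congr_deriv ?_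
    set L := Real.log (2 / x)
    set M := Real.log L
    rw [show -(q - 1) - 1 = -q by ring, Real.rpow_neg hM.le]
    have : M ^ q ≠ 0 := by positivity
    have : q - 1 ≠ 0 := by linarith
    field_simp
  · have hL := h.log_pos x hx
    have hM := h.log_log_pos x hx
    have hx0 := hx.1
    positivity
  · have h1 := Real.tendsto_log_atTop.comp tendsto_log_two_div
    have h3 := ((tendsto_rpow_neg_atTop (by linarith : 0 < q - 1)).comp h1).const_mul (q - 1)⁻¹
    rw [mul_zero] at h3
    exact h3

theorem exists_log_gCore_le (h : IsAdmissibleCutoff s ε) (hs : 0 < s) :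
    ∃ C : ℝ, 0 < C ∧ ∀ x ∈ Set.Ioc 0 ε,
      Real.log (gCore s x + 1) ≤ C * Real.log (2 / x) := by
  set m := Real.log (Real.log (2 / ε)) with hm
  have hεm : ε ∈ Set.Ioc 0 ε := ⟨h.pos, le_rfl⟩
  have hm0 : 0 < m := h.log_log_pos ε hεm
  set K := (1 + m⁻¹) * (m ^ s)⁻¹ with hK
  have hK0 : 0 < K := by positivity
  refine ⟨Real.log (K + 1) + 1, ?_, fun x hx => ?_⟩
  · have := Real.log_pos (show 1 < K + 1 by linarith); linarith
  have hx0 := hx.1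
  have hx1 : x < 1 := hx.2.trans_lt h.lt_one
  have hL := h.log_pos x hx
  have hM := h.log_log_pos x hx
  have hL1 := log_gt_one_of hL hM
  have hmM : m ≤ Real.log (Real.log (2 / x)) :=
    Real.log_le_log (h.log_pos ε hεm) (log_two_div_anti hx0 hx.2)
  have hle : gCore s x ≤ K * (2 / x) := by
    rw [gCore]
    set L := Real.log (2 / x)
    set M := Real.log L
    calc (M + 1) / (x / 2 * L ^ (s + 1) * M ^ (s + 1))
        = (1 + M⁻¹) * (M ^ s)⁻¹ * (L ^ (s + 1))⁻¹ * (2 / x) := by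
          rw [Real.rpow_add_one hM.ne']; field_simp
      _ ≤ (1 + m⁻¹) * (m ^ s)⁻¹ * 1 * (2 / x) := by
          gcongr
          exact inv_le_one_of_one_le₀ (Real.one_le_rpow hL1.le (by linarith))
      _ = _ := by rw [mul_one]
  have h2x : 1 ≤ 2 / x := by rw [le_div_iff₀ hx0]; linarith
  have h3 : gCore s x + 1 ≤ (K + 1) * (2 / x) := by linarith
  have h4 := Real.log_le_log (by have := gCore_pos (s := s) hx0 hL hM; linarith) h3
  rw [Real.log_mul (by positivity) (by positivity)] at h4
  have h5 : Real.log (K + 1) * 1 ≤ Real.log (K + 1) * Real.log (2 / x) :=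
    mul_le_mul_of_nonneg_left hL1.le (Real.log_nonneg (by linarith))
  linarith

theorem integrable_indicator (F : ℝ → ℝ) (hF : IntegrableOn F (Set.Ioc 0 ε)) :
    Integrable (fun x : Set.Ico (0 : ℝ) 1 => (Set.Icc 0 ε).indicator F (x : ℝ)) lebesgueIco := by
  refine (integrableOn_iff_comap_subtypeVal (s := Set.Ico (0 : ℝ) 1)
    (f := (Set.Icc 0 ε).indicator F) measurableSet_Ico).1 ?_
  refine Integrable.integrableOn ?_
  rw [integrable_indicator_iff measurableSet_Icc, integrableOn_Icc_iff_integrableOn_Ioc]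
  exact hF

theorem memLLogL_of_integrableOn {p : ℝ} (h : IsAdmissibleCutoff s ε) (hs : 0 < s)
    (hp : IntegrableOn (fun x => gCore s x * Real.log (gCore s x + 1) ^ p) (Set.Ioc 0 ε)) :
    MemLLogL p (fun x : Set.Ico (0 : ℝ) 1 => gFun s ε (x : ℝ)) lebesgueIco := by
  refine ⟨integrable_indicator (gCore s) (h.integrableOn_gCore hs), ?_⟩
  have h1 := integrable_indicator (fun x => |gCore s x| * Real.log (|gCore s x| + 1) ^ p)
    (hp.congr_fun (fun x hx => by
      have := gCore_pos (s := s) hx.1 (h.log_pos x hx) (h.log_log_pos x hx)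
      simp only [abs_of_pos this]) measurableSet_Ioc)
  refine h1.congr (ae_of_all _ fun x => ?_)
  by_cases hx : (x : ℝ) ∈ Set.Icc 0 ε
  · simp only [gFun, Set.indicator_of_mem hx]; rfl
  · simp only [gFun, Set.indicator_of_notMem hx, abs_zero, zero_mul]

/-- Since `log (g + 1) = O(log (2 / x))`, only `g` times `log (2 / x) ^ p` matters. For `0 ≤ p < s`
this is a bounded multiple of `gCore (s - p)`. For `p = s` the power of `log (2 / x)` left in the
denominator is 1, and integrability rests on the power `s > 1` of the iterated logarithm. -/
theorem memLLogL (h : IsAdmissibleCutoff s ε) (hs : 0 < s) {p : ℝ}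
    (hp : (s ≤ 1 ∧ p < s) ∨ (1 < s ∧ p ≤ s)) :
    MemLLogL p (fun x : Set.Ico (0 : ℝ) 1 => gFun s ε (x : ℝ)) lebesgueIco := by
  apply h.memLLogL_of_integrableOn hs
  have hεm : ε ∈ Set.Ioc 0 ε := ⟨h.pos, le_rfl⟩
  have hmeas : AEStronglyMeasurable (fun x => gCore s x * Real.log (gCore s x + 1) ^ p)
      (volume.restrict (Set.Ioc 0 ε)) := by
    have := measurable_gCore s
    exact Measurable.aestronglyMeasurable (by fun_prop)
  have hdom : ∀ F : ℝ → ℝ, IntegrableOn F (Set.Ioc 0 ε) →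
      (∀ x ∈ Set.Ioc 0 ε, gCore s x * Real.log (gCore s x + 1) ^ p ≤ F x) →
      IntegrableOn (fun x => gCore s x * Real.log (gCore s x + 1) ^ p) (Set.Ioc 0 ε) := by
    intro F hF hle
    refine Integrable.mono' hF hmeas ?_
    refine (ae_restrict_iff' measurableSet_Ioc).2 (ae_of_all _ fun x hx => ?_)
    have h1 := gCore_pos (s := s) hx.1 (h.log_pos x hx) (h.log_log_pos x hx)
    have h2 : 0 ≤ Real.log (gCore s x + 1) := Real.log_nonneg (by linarith)
    rw [Real.norm_of_nonneg (by positivity)]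
    exact hle x hx
  obtain ⟨C, hC, hCle⟩ := h.exists_log_gCore_le hs
  set m := Real.log (Real.log (2 / ε)) with hm
  have hm0 : 0 < m := h.log_log_pos ε hεm
  rcases lt_or_ge p 0 with hp0 | hp0
  -- For negative `p` the logarithmic factor is largest where `g` is smallest, namely at `ε`.
  · refine hdom _ ((h.integrableOn_gCore hs).mul_const (Real.log (gCore s ε + 1) ^ p))
      fun x hx => ?_
    have h1 := gCore_pos (s := s) hx.1 (h.log_pos x hx) (h.log_log_pos x hx)
    have h2 := gCore_pos (s := s) hεm.1 (h.log_pos ε hεm) (h.log_log_pos ε hεm)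
    have h3 : gCore s ε ≤ gCore s x := by
      rw [← gFun_of_mem hεm, ← gFun_of_mem hx]
      exact h.antitoneOn ⟨hx.1, hx.2.trans_lt h.lt_one⟩ ⟨h.pos, h.lt_one⟩ hx.2
    have h4 : 0 < Real.log (gCore s ε + 1) := Real.log_pos (by linarith)
    have h5 := Real.rpow_le_rpow_of_nonpos h4
      (Real.log_le_log (by linarith) (by linarith : gCore s ε + 1 ≤ gCore s x + 1)) hp0.le
    exact mul_le_mul_of_nonneg_left h5 h1.le
  have key : ∀ x ∈ Set.Ioc 0 ε, gCore s x * Real.log (gCore s x + 1) ^ p ≤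
      C ^ p * (gCore s x * Real.log (2 / x) ^ p) := by
    intro x hx
    have h1 := gCore_pos (s := s) hx.1 (h.log_pos x hx) (h.log_log_pos x hx)
    have h2 : 0 ≤ Real.log (gCore s x + 1) := Real.log_nonneg (by linarith)
    have h3 := Real.rpow_le_rpow h2 (hCle x hx) hp0
    rw [Real.mul_rpow hC.le (h.log_pos x hx).le] at h3
    calc _ ≤ gCore s x * (C ^ p * Real.log (2 / x) ^ p) := by gcongr
      _ = _ := by ring
  have hmM : ∀ x ∈ Set.Ioc 0 ε, m ≤ Real.log (Real.log (2 / x)) := fun x hx =>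
    Real.log_le_log (h.log_pos ε hεm) (log_two_div_anti hx.1 hx.2)
  rcases lt_or_ge p s with hps | hps
  · refine hdom _ ((h.integrableOn_gCore (sub_pos.2 hps)).const_mul (C ^ p * (m ^ p)⁻¹))
      fun x hx => (key x hx).trans ?_
    have hx0 := hx.1
    have hL := h.log_pos x hx
    have hM := h.log_log_pos x hx
    have hmx := hmM x hx
    have h2 := gCore_pos (s := s - p) hx0 hL hM
    have h1 : gCore s x * Real.log (2 / x) ^ p =
        (Real.log (Real.log (2 / x)) ^ p)⁻¹ * gCore (s - p) x := by
      simp only [gCore]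
      set L := Real.log (2 / x)
      set M := Real.log L
      have e1 : L ^ (s + 1) = L ^ (s - p + 1) * L ^ p := by
        rw [← Real.rpow_add hL]; congr 1; ring
      have e2 : M ^ (s + 1) = M ^ (s - p + 1) * M ^ p := by
        rw [← Real.rpow_add hM]; congr 1; ring
      rw [e1, e2]
      field_simp
    rw [h1, mul_assoc]
    gcongr
  · have hs1 : 1 < s := by
      rcases hp with hp | hp
      · linarith [hp.2]
      · exact hp.1
    have hpeq : p = s := by
      rcases hp with hp | hp
      · linarith [hp.2]
      · exact le_antisymm hp.2 hps
    subst hpeq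
    refine hdom _ ((h.integrableOn_inv_mul_log_log hs1).const_mul (C ^ p * (2 * (1 + m⁻¹))))
      fun x hx => (key x hx).trans ?_
    have hx0 := hx.1
    have hL := h.log_pos x hx
    have hM := h.log_log_pos x hx
    have hmx := hmM x hx
    rw [mul_assoc]
    refine mul_le_mul_of_nonneg_left ?_ (by positivity)
    simp only [gCore]
    set L := Real.log (2 / x)
    set M := Real.log L
    calc (M + 1) / (x / 2 * L ^ (p + 1) * M ^ (p + 1)) * L ^ p
        = 2 * (1 + M⁻¹) * (x * (L * M ^ p))⁻¹ := by
          rw [Real.rpow_add_one hM.ne', Real.rpow_add_one hL.ne']; field_simp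
      _ ≤ _ := by gcongr

end IsAdmissibleCutoff

/-! ### Orbits of the irrational rotation -/

theorem coe_iterate_circleRotation (α : ℝ) (d : ℕ) (x : Set.Ico (0 : ℝ) 1) :
    (((circleRotation α)^[d] x : Set.Ico (0 : ℝ) 1) : ℝ) = Int.fract ((x : ℝ) + d * α) := by
  induction d with
  | zero => simp [Int.fract_eq_self.2 x.2]
  | succ d ih =>
    rw [Function.iterate_succ_apply']
    change Int.fract ((((circleRotation α)^[d] x : Set.Ico (0 : ℝ) 1) : ℝ) + α) = _
    rw [ih, Int.fract_eq_fract]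
    refine ⟨-⌊(x : ℝ) + d * α⌋, ?_⟩
    rw [Int.fract]; push_cast; ring

/-- Steps of length `θ` cannot jump over an interval longer than `θ`. Translating the interval far
to the right by an integer forces `j ≥ M`. -/
theorem exists_nat_mul_add_int_mem_Ioo {θ u v : ℝ} (hθ : 0 < θ) (hθ' : θ < v - u) (M : ℕ) :
    ∃ j : ℕ, M ≤ j ∧ ∃ z : ℤ, u < j * θ - z ∧ j * θ - z < v := by
  obtain ⟨Z, hZ⟩ := exists_int_gt (M * θ - u)
  set j := ⌊(u + Z) / θ⌋₊ + 1 with hj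
  have hM : 0 ≤ M * θ := by positivity
  have hpos : 0 ≤ (u + Z) / θ := div_nonneg (by linarith) hθ.le
  have h1 : (u + Z) / θ < j := by rw [hj]; push_cast; exact Nat.lt_floor_add_one _
  have h2 : (j : ℝ) ≤ (u + Z) / θ + 1 := by
    rw [hj]; push_cast; gcongr; exact Nat.floor_le hpos
  refine ⟨j, ?_, Z, ?_, ?_⟩
  · have h3 : (M : ℝ) < (u + Z) / θ := by rw [lt_div_iff₀ hθ]; linarith
    exact_mod_cast (h3.trans h1).le
  · rw [div_lt_iff₀ hθ] at h1; linarith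
  · have h3 := mul_le_mul_of_nonneg_right h2 hθ.le
    rw [add_mul, div_mul_cancel₀ _ hθ.ne'] at h3
    linarith

/-- Equidistribution in weak form: large multiples of an irrational number are dense modulo 1. -/
theorem Irrational.exists_nat_mul_sub_int_mem_Ioo {α : ℝ} (hα : Irrational α) {u v : ℝ}
    (huv : u < v) (M : ℕ) : ∃ d : ℕ, M ≤ d ∧ ∃ z : ℤ, u < d * α - z ∧ d * α - z < v := by
  obtain ⟨N, hN⟩ := exists_nat_one_div_lt (sub_pos.2 huv)
  obtain ⟨b, d₀, hd₀, hdN, hle⟩ := Real.exists_int_int_abs_mul_sub_le α (Nat.succ_pos N)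
  obtain ⟨m, rfl⟩ : ∃ m : ℕ, d₀ = m := ⟨d₀.toNat, (Int.toNat_of_nonneg hd₀.le).symm⟩
  have hm : 1 ≤ m := by exact_mod_cast hd₀
  push_cast at hle
  set θ := (m : ℝ) * α - b with hθ
  have hθ0 : θ ≠ 0 := by
    intro h0
    refine hα ⟨(b : ℚ) / m, ?_⟩
    have : (m : ℝ) ≠ 0 := by positivity
    push_cast
    rw [div_eq_iff this]
    linarith
  have hsmall : |θ| < v - u := by
    refine lt_of_le_of_lt (hle.trans ?_) hN
    apply one_div_le_one_div_of_le (by positivity)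
    linarith
  rcases lt_or_gt_of_ne hθ0 with hneg | hpos
  · rw [abs_of_neg hneg] at hsmall
    obtain ⟨j, hj, z, h1, h2⟩ := exists_nat_mul_add_int_mem_Ioo (u := -v) (v := -u)
      (neg_pos.2 hneg) (by linarith) M
    refine ⟨j * m, hj.trans (Nat.le_mul_of_pos_right _ hm), j * b - z, ?_, ?_⟩ <;>
    · push_cast
      have : (j : ℝ) * m * α - (j * b - z) = j * θ + z := by rw [hθ]; ring
      rw [this]; linarith
  · rw [abs_of_pos hpos] at hsmall
    obtain ⟨j, hj, z, h1, h2⟩ := exists_nat_mul_add_int_mem_Ioo hpos hsmall M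
    refine ⟨j * m, hj.trans (Nat.le_mul_of_pos_right _ hm), j * b + z, ?_, ?_⟩ <;>
    · push_cast
      have : (j : ℝ) * m * α - (j * b + z) = j * θ - z := by rw [hθ]; ring
      rw [this]; linarith

theorem Irrational.exists_strictMono_nat_mul_mem_Ioo {α : ℝ} (hα : Irrational α) {u v : ℕ → ℝ}
    (huv : ∀ i, u i < v i) (M : ℕ) : ∃ d : ℕ → ℕ, StrictMono d ∧ (∀ i, M ≤ d i) ∧
      ∀ i, ∃ z : ℤ, u i < d i * α - z ∧ d i * α - z < v i := by
  choose f hf hz using fun i M => hα.exists_nat_mul_sub_int_mem_Ioo (huv i) M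
  set d : ℕ → ℕ := fun i => Nat.rec (f 0 M) (fun i x => f (i + 1) (x + 1)) i with hd
  have hsucc : ∀ i, d (i + 1) = f (i + 1) (d i + 1) := fun i => rfl
  have hmono : StrictMono d := strictMono_nat_of_lt_succ fun i => by
    rw [hsucc]; exact hf _ _
  refine ⟨d, hmono, fun i => (hf 0 M).trans (hmono.monotone (Nat.zero_le i)), fun i => ?_⟩
  cases i with
  | zero => exact hz 0 M
  | succ i => rw [hsucc]; exact hz _ _

/-! ### Perturbations aimed at the singularity -/

namespace IsAdmissibleCutoff

variable {s ε : ℝ}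

theorem exists_slope_gPrim (h : IsAdmissibleCutoff s ε) (hs : 0 < s) {u v : ℝ} (hu : 0 < u)
    (huv : u < v) (hv : v ≤ ε) :
    ∃ ξ ∈ Set.Ioo u v, gPrim s v - gPrim s u = gFun s ε ξ * (v - u) := by
  have hd : ∀ x ∈ Set.Icc u v, HasDerivAt (gPrim s) (gCore s x) x := fun x hx => by
    have hx' : x ∈ Set.Ioc 0 ε := ⟨hu.trans_le hx.1, hx.2.trans hv⟩
    exact hasDerivAt_gPrim hs.ne' hx'.1 (h.log_pos x hx') (h.log_log_pos x hx')
  obtain ⟨ξ, hξ, hξ'⟩ := exists_hasDerivAt_eq_slope (gPrim s) (gCore s) huv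
    (fun x hx => (hd x hx).continuousAt.continuousWithinAt)
    (fun x hx => hd x (Set.Ioo_subset_Icc_self hx))
  refine ⟨ξ, hξ, ?_⟩
  rw [gFun_of_mem ⟨hu.trans hξ.1, hξ.2.le.trans hv⟩, hξ', div_mul_cancel₀ _ (by linarith)]

theorem gPrim_sub_le (h : IsAdmissibleCutoff s ε) (hs : 0 < s) {u v : ℝ} (hu : 0 < u)
    (huv : u < v) (hv : v ≤ ε) : gPrim s v - gPrim s u ≤ gFun s ε u * (v - u) := by
  obtain ⟨ξ, hξ, h1⟩ := h.exists_slope_gPrim hs hu huv hv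
  rw [h1]
  have h2 := h.lt_one
  exact mul_le_mul_of_nonneg_right (h.antitoneOn ⟨hu, by linarith⟩
    ⟨hu.trans hξ.1, by linarith [hξ.2]⟩ hξ.1.le) (by linarith)

theorem gPrim_mono (h : IsAdmissibleCutoff s ε) (hs : 0 < s) {u v : ℝ} (hu : 0 < u)
    (huv : u ≤ v) (hv : v ≤ ε) : gPrim s u ≤ gPrim s v := by
  rcases huv.eq_or_lt with rfl | huv
  · exact le_rfl
  obtain ⟨ξ, hξ, h1⟩ := h.exists_slope_gPrim hs hu huv hv
  have h2 := gFun_nonneg (s := s) h.log_pos h.log_log_pos (hu.trans hξ.1).le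
  have := mul_nonneg h2 (sub_nonneg.2 huv.le)
  linarith

/-- Left endpoint sums of a decreasing function dominate its integral. The nodes start at `2 * η`
because a sample point is only known to lie below `η * (j + 2)`. -/
theorem gPrim_sub_le_sum (h : IsAdmissibleCutoff s ε) (hs : 0 < s) {η : ℝ} (hη : 0 < η) (m : ℕ)
    (hm : η * (m + 2) ≤ ε) :
    gPrim s (η * (m + 2)) - gPrim s (η * 2) ≤
      η * ∑ j ∈ Finset.range m, gFun s ε (η * (j + 2)) := by
  induction m with
  | zero => simp
  | succ m ih =>
    push_cast at hm ⊢
    have h1 := ih (by nlinarith)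
    have h2 := h.gPrim_sub_le hs (u := η * (m + 2)) (v := η * (m + 1 + 2)) (by positivity)
      (by gcongr; linarith) hm
    rw [Finset.sum_range_succ]
    have h3 : gFun s ε (η * (m + 2)) * (η * (m + 1 + 2) - η * (m + 2)) =
      η * gFun s ε (η * (m + 2)) := by ring
    linarith

/-- The contribution of one point in each of `n` cells of `[-S - e, -S + e]`. -/
theorem gPrim_sub_le_sum_fract (h : IsAdmissibleCutoff s ε) (hs : 0 < s) {e S α : ℝ} (he : 0 < e)
    (he' : 4 * e ≤ ε) {n : ℕ} (hn : 2 ≤ n) {d : ℕ → ℕ}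
    (hd : ∀ i : ℕ, ∃ z : ℤ, -S - e + 2 * e / n * i < d i * α - z ∧
      d i * α - z < -S - e + 2 * e / n * (i + 1)) {y : ℝ} (hy : y ∈ Set.Icc S (S + e)) :
    gPrim s e - gPrim s (4 * e / n) ≤
      2 * e / n * ∑ i ∈ Finset.range n, gFun s ε (Int.fract (y + d i * α)) := by
  have hn' : (2 : ℝ) ≤ n := by exact_mod_cast hn
  have hn0 : (0 : ℝ) < n := by linarith
  set η := 2 * e / n with hη
  have hη0 : 0 < η := by positivity
  have hηn : η * n = 2 * e := by rw [hη]; field_simp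
  have hηe : η ≤ e := by rw [hη, div_le_iff₀ hn0]; nlinarith
  obtain ⟨hy1, hy2⟩ := hy
  -- The first cell whose translate by `y` lies entirely to the right of 0. Rounding up costs one
  -- `η` and the position inside a cell another; this is the 2 in `j + 2`.
  set i₀ := ⌈(e - (y - S)) / η⌉₊ with hi₀
  have hb1 : e - (y - S) ≤ η * i₀ := by
    have := Nat.le_ceil ((e - (y - S)) / η)
    rw [div_le_iff₀ hη0] at this
    linarith
  have hb2 : η * i₀ < e - (y - S) + η := by
    have := Nat.ceil_lt_add_one (a := (e - (y - S)) / η) (div_nonneg (by linarith) hη0.le)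
    have h3 := mul_lt_mul_of_pos_left this hη0
    rw [mul_add, mul_div_cancel₀ _ hη0.ne'] at h3
    linarith
  have hi₀n : i₀ < n := by
    have : η * i₀ < η * n := by linarith
    exact_mod_cast lt_of_mul_lt_mul_left this hη0.le
  have hεlt := h.lt_one
  have hsum := h.gPrim_sub_le_sum hs hη0 (n - i₀) (by
    rw [Nat.cast_sub hi₀n.le]
    have : 0 ≤ η * i₀ := by positivity
    nlinarith)
  rw [Nat.cast_sub hi₀n.le] at hsum
  have hmono := h.gPrim_mono hs he (v := η * (n - i₀ + 2)) (by nlinarith) (by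
    have : 0 ≤ η * i₀ := by positivity
    nlinarith)
  have h4 : 4 * e / n = η * 2 := by rw [hη]; ring
  rw [h4]
  have hle : ∑ j ∈ Finset.range (n - i₀), gFun s ε (η * (j + 2)) ≤
      ∑ i ∈ Finset.range n, gFun s ε (Int.fract (y + d i * α)) := by
    have h5 : ∑ i ∈ Finset.Ico i₀ n, gFun s ε (Int.fract (y + d i * α)) ≤
        ∑ i ∈ Finset.range n, gFun s ε (Int.fract (y + d i * α)) := by
      refine Finset.sum_le_sum_of_subset_of_nonneg ?_ fun i _ _ =>
        gFun_nonneg h.log_pos h.log_log_pos (Int.fract_nonneg _)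
      intro i hi
      rw [Finset.mem_Ico] at hi
      exact Finset.mem_range.2 hi.2
    refine le_trans ?_ h5
    rw [Finset.sum_Ico_eq_sum_range]
    refine Finset.sum_le_sum fun j hj => ?_
    rw [Finset.mem_range] at hj
    have hj' : (j : ℝ) + i₀ + 1 ≤ n := by exact_mod_cast (by omega : j + i₀ + 1 ≤ n)
    obtain ⟨z, hz1, hz2⟩ := hd (i₀ + j)
    push_cast at hz1 hz2
    set w := y + d (i₀ + j) * α - z with hw
    have hj0 : 0 ≤ η * j := by positivity
    have hi0' : 0 ≤ η * i₀ := by positivity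
    have hw1 : 0 < w := by nlinarith
    have hw2 : w ≤ η * (j + 2) := by nlinarith
    have hw3 : η * (j + 2) < 1 := by nlinarith
    have hfr : Int.fract (y + d (i₀ + j) * α) = w := by
      rw [Int.fract_eq_iff]
      exact ⟨hw1.le, by linarith, z, by rw [hw]; ring⟩
    rw [hfr]
    exact h.antitoneOn ⟨hw1, by linarith⟩ ⟨by positivity, hw3⟩ hw2
  have h6 := mul_le_mul_of_nonneg_left hle hη0.le
  linarith

/-- With `n = ⌊c * l⌋₊` samples at spacing `2 * e / n`, the sum is at least `n / (2 * e)` times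
`gPrim s e - gPrim s (4 * e / n)`. For large `l` the subtracted term is below half of `gPrim s e`
and `n ≥ c * l / 2`; these losses make up the 8 in the hypothesis. -/
theorem exists_pert (h : IsAdmissibleCutoff s ε) (hs : 0 < s) {α : ℝ} (hα : Irrational α)
    {e c : ℝ} (he : 0 < e) (he' : 4 * e ≤ ε) (hc : 0 < c) (hec : 8 * e ≤ c * gPrim s e) (S : ℝ) :
    ∃ l₀ : ℕ, ∀ l : ℕ, l₀ ≤ l → ∀ M : ℕ, ∃ D : Finset ℕ, D.card = ⌊c * l⌋₊ ∧ (∀ d ∈ D, M ≤ d) ∧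
      ∀ y ∈ Set.Icc S (S + e), (l : ℝ) ≤ ∑ d ∈ D, gFun s ε (Int.fract (y + d * α)) := by
  have hG : 0 < gPrim s e := by
    by_contra! hcon
    have := mul_nonpos_of_nonneg_of_nonpos hc.le hcon
    linarith
  have hcl : Tendsto (fun l : ℕ => c * (l : ℝ)) atTop atTop :=
    tendsto_natCast_atTop_atTop.const_mul_atTop hc
  have hfl : Tendsto (fun l : ℕ => ⌊c * (l : ℝ)⌋₊) atTop atTop := tendsto_nat_floor_atTop.comp hcl
  have hsmall : Tendsto (fun l : ℕ => gPrim s (4 * e / (⌊c * (l : ℝ)⌋₊ : ℕ))) atTop (𝓝 0) := by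
    refine (tendsto_gPrim hs).comp (tendsto_nhdsWithin_iff.2 ⟨?_, ?_⟩)
    · exact (tendsto_natCast_atTop_atTop.comp hfl).const_div_atTop (4 * e)
    · filter_upwards [hfl.eventually_ge_atTop 1] with l hl
      have : (0 : ℝ) < (⌊c * (l : ℝ)⌋₊ : ℕ) := by exact_mod_cast hl
      exact div_pos (by linarith) this
  obtain ⟨l₀, hl₀⟩ := eventually_atTop.1 ((hcl.eventually_ge_atTop 4).and
    ((hfl.eventually_ge_atTop 2).and (hsmall.eventually (gt_mem_nhds (half_pos hG)))))
  refine ⟨l₀, fun l hl M => ?_⟩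
  obtain ⟨h1, h2, h3⟩ := hl₀ l hl
  set n := ⌊c * (l : ℝ)⌋₊ with hn
  have hn0 : (0 : ℝ) < n := by exact_mod_cast (by omega : 0 < n)
  obtain ⟨d, hdmono, hdM, hd⟩ := hα.exists_strictMono_nat_mul_mem_Ioo
    (u := fun i : ℕ => -S - e + 2 * e / n * i) (v := fun i : ℕ => -S - e + 2 * e / n * (i + 1))
    (fun i => by
      have : 0 < 2 * e / n := by positivity
      linarith) M
  refine ⟨(Finset.range n).map ⟨d, hdmono.injective⟩, by simp, ?_, fun y hy => ?_⟩
  · intro x hx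
    obtain ⟨i, -, rfl⟩ := Finset.mem_map.1 hx
    exact hdM i
  · rw [Finset.sum_map]
    simp only [Function.Embedding.coeFn_mk]
    have h4 := h.gPrim_sub_le_sum_fract hs he he' h2 hd hy
    set Q := ∑ i ∈ Finset.range n, gFun s ε (Int.fract (y + d i * α)) with hQ
    have h5 : c * l / 2 ≤ n := by
      have := Nat.lt_floor_add_one (c * (l : ℝ))
      rw [← hn] at this
      linarith
    have h6 : gPrim s e / 2 * n ≤ 2 * e * Q := by
      have h7 : gPrim s e / 2 ≤ 2 * e / n * Q := by linarith
      rw [div_mul_eq_mul_div, le_div_iff₀ hn0] at h7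
      exact h7
    have h8 : gPrim s e / 2 * (c * l / 2) ≤ gPrim s e / 2 * n :=
      mul_le_mul_of_nonneg_left h5 (by linarith)
    have h9 : 8 * e * l ≤ c * gPrim s e * l := mul_le_mul_of_nonneg_right hec (by positivity)
    have h10 : 2 * e * l ≤ 2 * e * Q := by linarith
    exact le_of_mul_le_mul_left h10 (by linarith)

end IsAdmissibleCutoff

/-! ### Targets covering the circle, and assembly -/

/-- The widths of the targets of the perturbations. -/
noncomputable def targetWidth (k : ℕ) : ℝ := 1 / (k * Real.log k)

theorem targetWidth_pos {k : ℕ} (hk : 3 ≤ k) : 0 < targetWidth k := by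
  have := one_lt_log_natCast hk
  have : (0 : ℝ) < k := by exact_mod_cast (by omega : 0 < k)
  rw [targetWidth]; positivity

theorem tendsto_natCast_log_atTop : Tendsto (fun k : ℕ => Real.log k) atTop atTop :=
  Real.tendsto_log_atTop.comp tendsto_natCast_atTop_atTop

theorem tendsto_log_log_atTop : Tendsto (fun k : ℕ => Real.log (Real.log k)) atTop atTop :=
  Real.tendsto_log_atTop.comp tendsto_natCast_log_atTop

theorem tendsto_targetWidth : Tendsto targetWidth atTop (𝓝 0) := by
  have h1 := (tendsto_natCast_atTop_atTop (R := ℝ)).atTop_mul_atTop₀ tendsto_natCast_log_atTop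
  have h2 := tendsto_inv_atTop_zero.comp h1
  refine h2.congr fun k => ?_
  simp [targetWidth]

/-- With `A = log k` and `B = log A`, the right side is at least a constant times `B / (k * A)`,
that is `B` times the target width. The spare factor `B` tends to infinity and beats the constant;
this is the purpose of the factor `log log k` in `c_k`. -/
theorem eventually_le_ratioSeq_mul_gPrim {s : ℝ} (hs : 0 < s) :
    ∀ᶠ k : ℕ in atTop, 8 * targetWidth k ≤ ratioSeq s k * gPrim s (targetWidth k) := by
  filter_upwards [eventually_ge_atTop 3, tendsto_log_log_atTop.eventually_ge_atTop (Real.log 3),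
    tendsto_log_log_atTop.eventually_ge_atTop (4 * s * 6 ^ s)] with k hk hk1 hk2
  have hA := one_lt_log_natCast hk
  have hB := Real.log_pos hA
  have h3 : (3 : ℝ) ≤ k := by exact_mod_cast hk
  rw [ratioSeq_eq hk]
  have hL : Real.log (2 / targetWidth k) = Real.log 2 + Real.log k + Real.log (Real.log k) := by
    rw [targetWidth, div_div_eq_mul_div, div_one, Real.log_mul two_ne_zero (by positivity),
      Real.log_mul (by positivity) (by positivity), add_assoc]
  have h2k : Real.log 2 ≤ Real.log k := Real.log_le_log two_pos (by linarith)
  have h20 : 0 < Real.log 2 := Real.log_pos one_lt_two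
  have hBA : Real.log (Real.log k) ≤ Real.log k := by
    have := Real.log_le_sub_one_of_pos (show 0 < Real.log k by linarith)
    linarith
  set A := Real.log k
  set B := Real.log A
  rw [gPrim, hL]
  set L := Real.log 2 + A + B
  have hL1 : 1 < L := by simp only [L]; linarith
  have hL3 : L ≤ 3 * A := by simp only [L]; linarith
  have hlL0 : 0 < Real.log L := Real.log_pos hL1
  have hlL : Real.log L ≤ 2 * B := by
    have := Real.log_le_log (by linarith) hL3
    rw [Real.log_mul (by norm_num) (by linarith)] at this
    linarith
  have hprod : L * Real.log L ≤ 6 * (A * B) := by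
    calc L * Real.log L ≤ (3 * A) * (2 * B) := by gcongr
      _ = _ := by ring
  have hpow : (6 * (A * B)) ^ (-s) ≤ (L * Real.log L) ^ (-s) :=
    Real.rpow_le_rpow_of_nonpos (by positivity) hprod (by linarith)
  have hA0 : 0 < A := by linarith
  have hk0 : (0 : ℝ) < k := by linarith
  have hexp : (6 * (A * B)) ^ (-s) = (6 ^ s)⁻¹ * (A ^ s)⁻¹ * (B ^ s)⁻¹ := by
    rw [Real.mul_rpow (by norm_num) (by positivity), Real.mul_rpow hA0.le hB.le,
      Real.rpow_neg (by norm_num), Real.rpow_neg hA0.le, Real.rpow_neg hB.le, mul_assoc]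
  rw [hexp] at hpow
  have h6 : (0 : ℝ) < 6 ^ s := by positivity
  calc 8 * targetWidth k = 2 / s * (6 ^ s)⁻¹ * (4 * s * 6 ^ s) * targetWidth k := by
        field_simp; ring
    _ ≤ 2 / s * (6 ^ s)⁻¹ * B * targetWidth k := by
        have := targetWidth_pos hk
        gcongr
    _ = A ^ (s - 1) * B ^ (s + 1) / k * (2 / s * ((6 ^ s)⁻¹ * (A ^ s)⁻¹ * (B ^ s)⁻¹)) := by
        rw [Real.rpow_add_one hB.ne', Real.rpow_sub_one hA0.ne', show targetWidth k = 1 / (k * A) from rfl]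
        have : A ^ s ≠ 0 := by positivity
        have : B ^ s ≠ 0 := by positivity
        field_simp
    _ ≤ _ := by gcongr

/-- Every point of the circle lies in infinitely many targets. -/
theorem exists_add_int_mem_target (x : ℝ) (K : ℕ) : ∃ k, K ≤ k ∧ ∃ q : ℤ,
    x + q ∈ Set.Icc (Real.log (Real.log k)) (Real.log (Real.log k) + targetWidth k) := by
  set K' := max K 3 with hK'
  obtain ⟨q, hq⟩ := exists_int_gt (Real.log (Real.log K') - x)
  have hex : ∃ j : ℕ, x + q < Real.log (Real.log (K' + j : ℕ)) := by
    obtain ⟨j, hj1, hj2⟩ := ((tendsto_log_log_atTop.eventually_gt_atTop (x + q)).and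
      (eventually_ge_atTop K')).exists
    exact ⟨j - K', by rwa [Nat.add_sub_cancel' hj2]⟩
  classical
  have h1 := Nat.find_spec hex
  have h0 : Nat.find hex ≠ 0 := by
    intro h0
    rw [h0, add_zero] at h1
    linarith
  obtain ⟨j, hj⟩ := Nat.exists_eq_succ_of_ne_zero h0
  -- The point lies between two consecutive values of `log log`, whose gap is at most `targetWidth
  -- k`.
  have h2 := Nat.find_min hex (m := j) (by omega)
  rw [hj] at h1
  push Not at h2
  have hk3 : 3 ≤ K' + j := (le_max_right _ _).trans (Nat.le_add_right _ _)
  refine ⟨K' + j, (le_max_left _ _).trans (Nat.le_add_right _ _), q, h2, ?_⟩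
  refine h1.le.trans ?_
  have hA := one_lt_log_natCast hk3
  have hk0 : (0 : ℝ) < (K' + j : ℕ) := by exact_mod_cast (by omega : 0 < K' + j)
  rw [show K' + j.succ = (K' + j) + 1 by omega]
  set k := K' + j
  push_cast
  have h3 : Real.log ((k : ℝ) + 1) ≤ Real.log k + 1 / k := by
    have := Real.log_le_sub_one_of_pos (show 0 < ((k : ℝ) + 1) / k by positivity)
    rw [Real.log_div (by positivity) hk0.ne', add_div, div_self hk0.ne'] at this
    linarith
  have hA' : 0 < Real.log ((k : ℝ) + 1) := Real.log_pos (by linarith)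
  have h4 := Real.log_le_sub_one_of_pos
    (show 0 < Real.log ((k : ℝ) + 1) / Real.log k by positivity)
  rw [Real.log_div hA'.ne' (by positivity)] at h4
  have h5 : Real.log ((k : ℝ) + 1) / Real.log k ≤ 1 + targetWidth k := by
    rw [div_le_iff₀ (by linarith)]
    calc Real.log ((k : ℝ) + 1) ≤ Real.log k + 1 / k := h3
      _ = (1 + targetWidth k) * Real.log k := by rw [targetWidth]; field_simp
  linarith

/-- One stage for an arbitrary starting point `a`, so that the layout can be built by recursion.
Below the threshold `K` only the cardinality matters, and an interval serves as `D`. -/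
theorem exists_stage_pert {s ε α : ℝ} (h : IsAdmissibleCutoff s ε) (hs : 0 < s)
    (hα : Irrational α) :
    ∃ K : ℕ, ∀ k a : ℕ, ∃ (l : ℕ) (D : Finset ℕ), a ≤ l ∧ (k + 1) ^ 2 ≤ l ∧
      D.card = ⌊ratioSeq s (k + 1) * l⌋₊ ∧ (∀ d ∈ D, a + l ≤ d) ∧
      (K ≤ k + 1 → ∀ y ∈ Set.Icc (Real.log (Real.log (k + 1 : ℕ)))
        (Real.log (Real.log (k + 1 : ℕ)) + targetWidth (k + 1)),
        (l : ℝ) ≤ ∑ d ∈ D, gFun s ε (Int.fract (y + d * α))) := by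
  have hev : ∀ᶠ k : ℕ in atTop, 4 * targetWidth k < ε := by
    have := tendsto_targetWidth.const_mul 4
    rw [mul_zero] at this
    exact this.eventually (gt_mem_nhds h.pos)
  obtain ⟨K, hK⟩ := eventually_atTop.1
    ((hev.and (eventually_le_ratioSeq_mul_gPrim hs)).and (eventually_ge_atTop 3))
  refine ⟨K, fun k a => ?_⟩
  rcases le_or_gt K (k + 1) with hk | hk
  · obtain ⟨⟨h1, h2⟩, h3⟩ := hK _ hk
    have hc : 0 < ratioSeq s (k + 1) := by
      have hA := one_lt_log_natCast h3
      have hB := Real.log_pos hA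
      rw [ratioSeq_eq h3]
      have : (0 : ℝ) < (k + 1 : ℕ) := by positivity
      positivity
    obtain ⟨l₀, hl₀⟩ := h.exists_pert hs hα (targetWidth_pos h3) h1.le hc h2
      (Real.log (Real.log (k + 1 : ℕ)))
    set l := max l₀ (max a ((k + 1) ^ 2)) with hl
    obtain ⟨D, hD1, hD2, hD3⟩ := hl₀ l (le_max_left _ _) (a + l)
    exact ⟨l, D, (le_max_left _ _).trans (le_max_right _ _),
      (le_max_right _ _).trans (le_max_right _ _), hD1, hD2, fun _ => hD3⟩
  · set l := max a ((k + 1) ^ 2) with hl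
    refine ⟨l, Finset.Ico (a + l) (a + l + ⌊ratioSeq s (k + 1) * l⌋₊), le_max_left _ _,
      le_max_right _ _, by simp, fun d hd => (Finset.mem_Ico.1 hd).1, fun h => by omega⟩

theorem exists_layout {s ε α : ℝ} (h : IsAdmissibleCutoff s ε) (hs : 0 < s)
    (hα : Irrational α) :
    ∃ (a l : ℕ → ℕ) (D : ℕ → Finset ℕ), BlockLayout a l D ∧
      (∀ k, (D k).card = ⌊ratioSeq s (k + 1) * l k⌋₊) ∧
      ∃ K : ℕ, ∀ k, K ≤ k + 1 → ∀ y ∈ Set.Icc (Real.log (Real.log (k + 1 : ℕ)))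
        (Real.log (Real.log (k + 1 : ℕ)) + targetWidth (k + 1)),
        (l k : ℝ) ≤ ∑ d ∈ D k, gFun s ε (Int.fract (y + d * α)) := by
  obtain ⟨K, hK⟩ := exists_stage_pert h hs hα
  choose l D h1 h2 h3 h4 h5 using hK
  set a : ℕ → ℕ := fun k => Nat.rec 1 (fun k x => x + l k x + (D k x).sup _root_.id + 1) k with ha
  have hsucc : ∀ k, a (k + 1) = a k + l k (a k) + (D k (a k)).sup _root_.id + 1 := fun k => rfl
  refine ⟨a, fun k => l k (a k), fun k => D k (a k), ⟨le_rfl, fun k => h1 k _, fun k => h2 k _,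
    fun k => ?_, fun k => h4 k _, fun k d hd => ?_⟩, fun k => h3 k _, K, fun k => h5 k _⟩
  · rw [hsucc]; omega
  · have : d ≤ (D k (a k)).sup _root_.id := Finset.le_sup (f := _root_.id) hd
    rw [hsucc]; omega

theorem mainTheorem2 (s : ℝ) (hs : 0 < s) (α : ℝ) (hα : Irrational α) :
    (∃ ε : ℝ, IsAdmissibleCutoff s ε) ∧
    ∀ ε : ℝ, IsAdmissibleCutoff s ε →
      (∀ p : ℝ, ((s ≤ 1 ∧ p < s) ∨ (1 < s ∧ p ≤ s)) →
        MemLLogL p (fun x : Set.Ico (0 : ℝ) 1 => gFun s ε (x : ℝ)) lebesgueIco) ∧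
      ∃ (B D : ℕ → Finset ℕ) (n : ℕ → ℕ),
        IsPerturbedBlockFamily B D ∧
        Enumerates n B D ∧
        (∀ k : ℕ, 3 ≤ k → (D k).card = ⌊ratioSeq s k * ((B k).card : ℝ)⌋₊) ∧
        (∀ᵐ x ∂lebesgueIco,
          ¬ AveragesConvergeAt (circleRotation α) n
            (fun x : Set.Ico (0 : ℝ) 1 => gFun s ε (x : ℝ)) x) ∧
        (∀ p : ℝ, s < p → IsUniversallyGoodLLogL.{u} p n) := by
  refine ⟨exists_isAdmissibleCutoff hs, fun ε h => ⟨fun p hp => h.memLLogL hs hp, ?_⟩⟩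
  obtain ⟨a, l, D, hlay, hDcard, K, hK⟩ := exists_layout h hs hα
  set U : Set ℕ := {m | ∃ k, m ∈ Finset.Ico (a k) (a k + l k) ∪ D k} with hU
  have hUinf : (Set.ofPred fun m => m ∈ U).Infinite := by
    refine Set.infinite_of_injective_forall_mem hlay.strictMono_start.injective fun k => ?_
    refine ⟨k, Finset.mem_union_left _ (Finset.mem_Ico.2 ?_)⟩
    have := hlay.length_pos k
    omega
  set n : ℕ → ℕ := Nat.nth (fun m => m ∈ U) with hn
  have hnmono : StrictMono n := Nat.nth_strictMono hUinf
  have hrange : Set.range n = U := Nat.range_nth_of_infinite hUinf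
  have hDle : ∀ k, ((D k).card : ℝ) ≤ |ratioSeq s (k + 1)| * l k := fun k => by
    rw [hDcard]
    rcases le_or_gt 0 (ratioSeq s (k + 1) * l k) with h0 | h0
    · exact (Nat.floor_le h0).trans (by gcongr; exact le_abs_self _)
    · rw [Nat.floor_of_nonpos h0.le]; simp only [Nat.cast_zero]; positivity
  have hlpos : ∀ k, (0 : ℝ) < l k := fun k => by exact_mod_cast hlay.length_pos k
  have hcard : Tendsto (fun k => ((D k).card : ℝ) / l k) atTop (𝓝 0) :=
    squeeze_zero (fun k => by positivity)
      (fun k => by rw [div_le_iff₀ (hlpos k)]; exact hDle k) (tendsto_abs_ratioSeq hs)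
  -- The layout is indexed from 0 and the block family from 1; this is why stage `k` uses `ratioSeq
  -- s (k + 1)`.
  refine ⟨fun k => Finset.Ico (a (k - 1)) (a (k - 1) + l (k - 1)), fun k => D (k - 1), n,
    ⟨?_, ?_, ?_, ?_⟩, ⟨hnmono, ?_⟩, ?_, ?_, ?_⟩
  · exact fun k _ => ⟨_, _, hlay.start_pos _, hlay.length_pos _, rfl⟩
  · intro k hk b hb b' hb'
    obtain ⟨k, rfl⟩ : ∃ j, k = j + 1 := ⟨k - 1, by omega⟩
    have := hlay.end_le_start k
    simp only [add_tsub_cancel_right, Finset.mem_Ico] at hb hb'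
    omega
  · intro k hk b hb d hd
    have := hlay.le_pert _ d hd
    have := (Finset.mem_Ico.1 hb).2
    omega
  · intro k hk d hd b hb
    obtain ⟨k, rfl⟩ : ∃ j, k = j + 1 := ⟨k - 1, by omega⟩
    have := hlay.pert_lt _ d hd
    simp only [add_tsub_cancel_right, Finset.mem_Ico] at hb this
    omega
  · rw [hrange, hU]
    ext m
    simp only [Set.mem_ofPred_eq]
    constructor
    · rintro ⟨k, hk⟩; exact ⟨k + 1, by omega, hk⟩
    · rintro ⟨k, -, hk⟩; exact ⟨k - 1, hk⟩
  · intro k hk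
    simp only [hDcard, Nat.card_Ico, add_tsub_cancel_left]
    rw [Nat.sub_add_cancel (by omega)]
  · refine ae_of_all _ fun x => ?_
    rintro ⟨L, hL⟩
    have h1 := hlay.tendsto_pert_of_tendsto_average hnmono hrange
      (F := fun i => gFun s ε (((circleRotation α)^[i] x : Set.Ico (0 : ℝ) 1) : ℝ)) hcard hL
    obtain ⟨N, hN⟩ := eventually_atTop.1 (h1.eventually (gt_mem_nhds one_pos))
    -- A late target containing `x` modulo 1 makes the sum over the perturbation at least its block
    -- length, while convergence would make it smaller.
    obtain ⟨k, hk, q, hq⟩ := exists_add_int_mem_target x (max K (N + 1))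
    have hk1 : K ≤ k := (le_max_left _ _).trans hk
    have hk2 : N + 1 ≤ k := (le_max_right _ _).trans hk
    obtain ⟨k, rfl⟩ : ∃ j, k = j + 1 := ⟨k - 1, by omega⟩
    have h2 := hK k hk1 _ hq
    have h3 := hN k (by omega)
    rw [div_lt_one (hlpos k)] at h3
    refine absurd h2 (not_le.2 (lt_of_eq_of_lt ?_ h3))
    refine Finset.sum_congr rfl fun d _ => ?_
    rw [coe_iterate_circleRotation, show (x : ℝ) + q + d * α = (x : ℝ) + d * α + q by ring,
      Int.fract_add_intCast]
  · intro p hp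
    obtain ⟨C, hC⟩ := sum_abs_ratioSeq_le hs hp
    exact isUniversallyGoodLLogL_of_layout hlay (fun k => abs_nonneg _) hDle hcard
      (tendsto_abs_ratioSeq_mul_sqrt hs) hC hnmono hrange
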